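/- \textbf{Theorem (Strong convergence of 1RDSA).} Let $f:\mathbb R^N\to\mathbb R$, let $\|\cdot\|$ be the Euclidean norm, and let $(a_n)_{n\ge0}$, $(\delta_n)_{n\ge0}$ be real sequences. On a probability space let $x_0$ and $d_n=(d_n^1,\dots,d_n^N)$, $n\ge 0$, be $\mathbb R^N$-valued random vectors and $\xi_n^+,\xi_n^-$, $n\ge0$, real random variables. Put $y_n^{\pm}=f(x_n\pm\delta_n d_n)+\xi_n^{\pm}$ and let $$x_{n+1}=x_n-a_n\widehat\nabla f(x_n),\qquad n\ge 0,$$ where one of the following two choices is made for all $n$: \begin{itemize} \item (uniform perturbations) for some $\eta>0$, each $d_n^i$ is uniformly distributed on $[-\eta,\eta]$, and $\widehat\nabla f(x_n)=\frac{3}{\eta^2}\,d_n\,\frac{y_n^+-y_n^-}{2\delta_n}$; or \item (asymmetric Bernoulli perturbations) for some $\epsilon>0$, each $d_n^i$ equals $-1$ with probability $\frac{1+\epsilon}{2+\epsilon}$ and $1+\epsilon$ with probability $\frac1{2+\epsilon}$, and $\widehat\nabla f(x_n)=\frac{1}{1+\epsilon}\,d_n\,\frac{y_n^+-y_n^-}{2\delta_n}$.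 \end{itemize} Let $\mathcal F_n=\sigma(x_m, m\le n)$, and assume: \begin{itemize} \item[(A1)] $f$ is three times continuously differentiable and there is $\alpha_0<\infty$ such that $|\nabla^3_{i_1i_2i_3}f(x)|<\alpha_0$ for all $i_1,i_2,i_3\in\{1,\dots,N\}$ and all $x\in\mathbb R^N$. \item[(A2)] $\mathbb E[\xi_n^+-\xi_n^-\mid d_n,\mathcal F_n]=0$ almost surely, for all $n$. \item[(A3)] There are $\alpha_1,\alpha_2,\zeta>0$ such that $\mathbb E|\xi_n^{\pm}|^{2+\zeta}\le\alpha_1$ and $\mathbb E|f(x_n\pm\delta_nd_n)|^{2+\zeta}\le\alpha_2$ for all $n$. \item[(A4)] The random variables $d_n^i$ ($1\le i\le N$, $n\ge0$) are i.i.d., and for each $n$ the vector $d_n$ is independent of $\mathcal F_n$. \item[(A5)] $a_n>0$ and $\delta_n>0$ for all $n$, $a_n\to0$, $\delta_n\to0$, $\sum_n a_n=\infty$ and $\sum_n (a_n/\delta_n)^2<\infty$. \item[(A6)] $\sup_n\|x_n\|<\infty$ almost surely. \end{itemize} Let $x^*$ be an asymptotically stable equilibrium of the ODE $\dot x=-\nabla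 f(x)$; that is, $\nabla f(x^*)=0$, $x^*$ is Lyapunov stable, and the domain of attraction $D(x^*)$ contains a neighbourhood of $x^*$, where $D(x^*)$ is the set of all initial points from which the solution of the ODE exists on $[0,\infty)$ and converges to $x^*$ as $t\to\infty$. Suppose that there is a (non-random) compact set $\mathcal D\subseteq D(x^*)$ such that, almost surely, $x_n\in\mathcal D$ for infinitely many $n$. Then $x_n\to x^*$ almost surely as $n\to\infty$. -/

import Mathlib

open MeasureTheory ProbabilityTheory Filter Topology

noncomputable section

namespace RDSA

/-- `ℝ^N` with its Euclidean norm. -/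
abbrev Vec (N : ℕ) : Type := EuclideanSpace ℝ (Fin N)

/-! ### The gradient flow and stability of its equilibria -/

/-- `γ` is a solution on `[0, ∞)` of the ODE `ẋ = -∇f(x)`. -/
def IsGradientFlow {N : ℕ} (f : Vec N → ℝ) (γ : ℝ → Vec N) : Prop :=
  IsIntegralCurveOn γ (fun _ x => -gradient f x) (Set.Ici 0)

/-- The domain of attraction of `xs`: all initial points from which the ODE `ẋ = -∇f(x)` has a
solution on `[0, ∞)` that converges to `xs`. (For `f` of class `C²` the solution with a given
initial point is unique.) -/
def domainOfAttraction {N : ℕ} (f : Vec N → ℝ) (xs : Vec N) : Set (Vec N) :=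
  {x₀ | ∃ γ : ℝ → Vec N, IsGradientFlow f γ ∧ γ 0 = x₀ ∧ Tendsto γ atTop (𝓝 xs)}

/-- `xs` is an asymptotically stable equilibrium of `ẋ = -∇f(x)`: it is an equilibrium, it is
Lyapunov stable, and it attracts all solutions that start near it. -/
structure IsAsymptoticallyStable {N : ℕ} (f : Vec N → ℝ) (xs : Vec N) : Prop where
  equilibrium : gradient f xs = 0
  stable : ∀ ε > 0, ∃ r > 0, ∀ γ : ℝ → Vec N, IsGradientFlow f γ → dist (γ 0) xs < r →
    ∀ t, 0 ≤ t → dist (γ t) xs < ε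
  attracting : ∃ r > 0, Metric.ball xs r ⊆ domainOfAttraction f xs

/-! ### Perturbations, gradient estimate and iterates -/

/-- The two kinds of random perturbation: uniform on `[-η, η]`, and asymmetric Bernoulli with
parameter `ε`. -/
inductive Perturbation : Type where
  | uniform (η : ℝ) (hη : 0 < η)
  | asymBernoulli (ε : ℝ) (hε : 0 < ε)

/-- The common law of the coordinates `d_n^i`. -/
def Perturbation.law : Perturbation → Measure ℝ
  | .uniform η _ => ProbabilityTheory.cond volume (Set.Icc (-η) η)
  | .asymBernoulli ε _ =>
      ENNReal.ofReal ((1 + ε) / (2 + ε)) • Measure.dirac (-1) +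
        ENNReal.ofReal (1 / (2 + ε)) • Measure.dirac (1 + ε)

/-- The scaling factor of the gradient estimate: `3/η²` or `1/(1+ε)`. -/
def Perturbation.scale : Perturbation → ℝ
  | .uniform η _ => 3 / η ^ 2
  | .asymBernoulli ε _ => 1 / (1 + ε)

/-- The gradient estimate at `x` with perturbation constant `δ`, perturbation vector `d`, and
measurement noises `ξp`, `ξm`. -/
def gradEstimate {N : ℕ} (p : Perturbation) (f : Vec N → ℝ) (δ : ℝ) (x d : Vec N)
    (ξp ξm : ℝ) : Vec N :=
  (p.scale * (((f (x + δ • d) + ξp) - (f (x - δ • d) + ξm)) / (2 * δ))) • d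

/-- The 1RDSA iterates `x_{n+1} = x_n - a_n ∇̂f(x_n)`, started at the random vector `x₀`. -/
def iterate {N : ℕ} {Ω : Type*} (p : Perturbation) (f : Vec N → ℝ) (a δ : ℕ → ℝ)
    (d : ℕ → Ω → Vec N) (ξp ξm : ℕ → Ω → ℝ) (x₀ : Ω → Vec N) : ℕ → Ω → Vec N
  | 0, ω => x₀ ω
  | n + 1, ω =>
      iterate p f a δ d ξp ξm x₀ n ω -
        a n • gradEstimate p f (δ n) (iterate p f a δ d ξp ξm x₀ n ω) (d n ω) (ξp n ω) (ξm n ω)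

/-- The σ-field `F_n = σ(x_m, m ≤ n)`. -/
abbrev history {N : ℕ} {Ω : Type*} (x : ℕ → Ω → Vec N) (n : ℕ) : MeasurableSpace Ω :=
  ⨆ m ≤ n, MeasurableSpace.comap (x m) inferInstance

/-- The entry `∇³_{i j k} f(x)` of the third derivative of `f` at `x`. -/
def thirdPartial {N : ℕ} (f : Vec N → ℝ) (i j k : Fin N) (x : Vec N) : ℝ :=
  iteratedFDeriv ℝ 3 f x
    ![EuclideanSpace.single i 1, EuclideanSpace.single j 1, EuclideanSpace.single k 1]

end RDSA

end

/-!
Write the recursion as `x (n + 1) = x n + a n • (-∇f (x n) + b n) + w n`, where `b n` is the bias of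
the gradient estimate given the past and `w n` is a martingale difference. The direction `d n` has
independent centred coordinates and is scaled so that `c ⟪∇f (x n), d n⟫ d n` has conditional mean
`∇f (x n)`; replacing this inner product by a symmetric difference quotient costs `O(δ n)`, so `b n`
tends to `0` along bounded iterates. Moreover `𝔼‖w n‖²` is of order `(a n / δ n) ^ 2`, which is
summable, so `∑ w n` converges almost surely. The rest is deterministic. Shifted by the tail of
`∑ w n`, the iterates become an Euler scheme for `ẋ = -∇f x` with vanishing errors, whose set of
cluster points is closed and invariant under the flow. A cluster point in the domain of attraction
therefore makes `x*` a cluster point too. Since flow lines decrease `f`, the point `x*` is a strict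
local minimum of `f` and an isolated critical point, and the nearly monotone decrease of `f` along
the iterates traps them close to `x*`.
-/

namespace RDSA

/-! ### Euler schemes and integral curves -/

section IntegralCurve

variable {E : Type*} [NormedAddCommGroup E] [NormedSpace ℝ E] {V : E → E} {γ : ℝ → E}
  {s : Set E} {K : NNReal} {B : ℝ}

theorem norm_integralCurve_sub_le (hγ : IsIntegralCurveOn γ (fun _ => V) (Set.Ici 0))
    (hB : ∀ t, 0 ≤ t → ‖V (γ t)‖ ≤ B) {r t : ℝ} (hr : 0 ≤ r) (ht : 0 ≤ t) :
    ‖γ t - γ r‖ ≤ B * |t - r| :=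
  Convex.norm_image_sub_le_of_norm_hasDerivWithin_le (fun x hx => hγ x hx) (fun x hx => hB x hx)
    (convex_Ici 0) hr ht

theorem norm_integralCurve_add_sub_euler_le
    (hγ : IsIntegralCurveOn γ (fun _ => V) (Set.Ici 0)) (hV : LipschitzOnWith K V s)
    (hγs : ∀ t, 0 ≤ t → γ t ∈ s) (hB : ∀ t, 0 ≤ t → ‖V (γ t)‖ ≤ B) {t h : ℝ} (ht : 0 ≤ t)
    (hh : 0 ≤ h) : ‖γ (t + h) - (γ t + h • V (γ t))‖ ≤ h * (K * (B * h)) := by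
  have hderiv : ∀ r ∈ Set.Icc t (t + h), HasDerivWithinAt (fun r => γ r - (r - t) • V (γ t))
      (V (γ r) - V (γ t)) (Set.Icc t (t + h)) r := fun r hr => by
    have hlin : HasDerivAt (fun r : ℝ => (r - t) • V (γ t)) (V (γ t)) r := by
      simpa using ((hasDerivAt_id r).sub_const t).smul_const (V (γ t))
    exact ((hγ r (ht.trans hr.1)).mono fun q hq => ht.trans hq.1).sub hlin.hasDerivWithinAt
  have hbound : ∀ r ∈ Set.Icc t (t + h), ‖V (γ r) - V (γ t)‖ ≤ K * (B * h) := fun r hr => by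
    have hB0 : 0 ≤ B := (norm_nonneg _).trans (hB t ht)
    have hr0 : 0 ≤ r := ht.trans hr.1
    calc ‖V (γ r) - V (γ t)‖ ≤ K * ‖γ r - γ t‖ := hV.norm_sub_le (hγs r hr0) (hγs t ht)
      _ ≤ K * (B * |r - t|) := by gcongr; exact norm_integralCurve_sub_le hγ hB ht hr0
      _ ≤ K * (B * h) := by
          rw [abs_of_nonneg (sub_nonneg.2 hr.1)]
          gcongr
          linarith [hr.2]
  have hmean := (convex_Icc t (t + h)).norm_image_sub_le_of_norm_hasDerivWithin_le hderiv hbound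
    (Set.left_mem_Icc.2 (by linarith)) (Set.right_mem_Icc.2 (by linarith))
  simpa [abs_of_nonneg hh, mul_comm h, sub_right_comm, ← sub_sub] using hmean

theorem norm_euler_step_sub_integralCurve_le
    (hγ : IsIntegralCurveOn γ (fun _ => V) (Set.Ici 0)) (hV : LipschitzOnWith K V s)
    (hγs : ∀ t, 0 ≤ t → γ t ∈ s) (hB : ∀ t, 0 ≤ t → ‖V (γ t)‖ ≤ B) {t h : ℝ} (ht : 0 ≤ t)
    (hh : 0 ≤ h) {x : E} (hx : x ∈ s) (w : E) :
    ‖x + h • (V x + w) - γ (t + h)‖ ≤ (1 + K * h) * ‖x - γ t‖ + (‖w‖ + K * (B * h)) * h := by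
  have hsplit : x + h • (V x + w) - γ (t + h) =
      x - γ t + h • (V x - V (γ t)) + h • w - (γ (t + h) - (γ t + h • V (γ t))) := by
    module
  calc ‖x + h • (V x + w) - γ (t + h)‖
      ≤ ‖x - γ t‖ + ‖h • (V x - V (γ t))‖ + ‖h • w‖ + ‖γ (t + h) - (γ t + h • V (γ t))‖ := by
        rw [hsplit]
        exact (norm_sub_le _ _).trans (by gcongr; exact norm_add₃_le)
    _ ≤ ‖x - γ t‖ + h * (K * ‖x - γ t‖) + h * ‖w‖ + h * (K * (B * h)) := by
        rw [norm_smul_of_nonneg hh, norm_smul_of_nonneg hh]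
        gcongr
        · exact hV.norm_sub_le hx (hγs t ht)
        · exact norm_integralCurve_add_sub_euler_le hγ hV hγs hB ht hh
    _ = (1 + K * h) * ‖x - γ t‖ + (‖w‖ + K * (B * h)) * h := by ring

variable {a : ℕ → ℝ} {z e : ℕ → E}

theorem norm_euler_sub_integralCurve_le (hγ : IsIntegralCurveOn γ (fun _ => V) (Set.Ici 0))
    (hV : LipschitzOnWith K V s) (hγs : ∀ t, 0 ≤ t → γ t ∈ s)
    (hB : ∀ t, 0 ≤ t → ‖V (γ t)‖ ≤ B) (ha : ∀ n, 0 ≤ a n)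
    (hz : ∀ n, z (n + 1) = z n + a n • (V (z n) + e n)) (hzs : ∀ n, z n ∈ s) {ε : ℝ}
    (hε : ∀ n, ‖e n‖ + K * (B * a n) ≤ ε) (n : ℕ) :
    ‖z n - γ (∑ i ∈ Finset.range n, a i)‖ ≤
      (‖z 0 - γ 0‖ + ε * ∑ i ∈ Finset.range n, a i) *
        Real.exp (K * ∑ i ∈ Finset.range n, a i) := by
  have hε0 : 0 ≤ ε := by
    have hB0 : 0 ≤ B := (norm_nonneg _).trans (hB 0 le_rfl)
    exact le_trans (by have := ha 0; positivity) (hε 0)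
  have hstep : ∀ n, ‖z (n + 1) - γ (∑ i ∈ Finset.range (n + 1), a i)‖ ≤
      (1 + K * a n) * ‖z n - γ (∑ i ∈ Finset.range n, a i)‖ + ε * a n := fun n => by
    rw [hz, Finset.sum_range_succ]
    refine (norm_euler_step_sub_integralCurve_le hγ hV hγs hB
      (Finset.sum_nonneg fun i _ => ha i) (ha n) (hzs n) (e n)).trans ?_
    have := ha n
    gcongr
    exact hε n
  have hgronwall := discrete_gronwall (u := fun n => ‖z n - γ (∑ i ∈ Finset.range n, a i)‖)
    (n₀ := 0) (norm_nonneg _) (fun n _ => hstep n) (fun n _ => mul_nonneg K.2 (ha n))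
    (fun n _ => mul_nonneg hε0 (ha n)) (Nat.zero_le n)
  simpa [← Finset.mul_sum, ← Finset.range_eq_Ico] using hgronwall

theorem exists_le_lt_succ_of_tendsto_atTop {u : ℕ → ℝ} (hu : Tendsto u atTop atTop) {t : ℝ}
    (ht : u 0 ≤ t) : ∃ k, u k ≤ t ∧ t < u (k + 1) := by
  by_contra! h
  obtain ⟨k, hk⟩ := (hu.eventually_gt_atTop t).exists
  exact hk.not_ge (Nat.rec ht (fun n hn => h n hn) k)

theorem tendsto_sum_range_add_atTop
    (ha_sum : Tendsto (fun n => ∑ i ∈ Finset.range n, a i) atTop atTop) (n : ℕ) :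
    Tendsto (fun k => ∑ i ∈ Finset.range k, a (n + i)) atTop atTop := by
  have hshift : ∀ k, ∑ i ∈ Finset.range k, a (n + i) =
      ∑ i ∈ Finset.range (k + n), a i + -∑ i ∈ Finset.range n, a i :=
    fun k => by rw [add_comm k n, Finset.sum_range_add]; abel
  simp_rw [hshift]
  exact tendsto_atTop_add_const_right _ _ ((tendsto_add_atTop_iff_nat n).2 ha_sum)

theorem mapClusterPt_integralCurve (hγ : IsIntegralCurveOn γ (fun _ => V) (Set.Ici 0))
    (hV : LipschitzOnWith K V s) (hγs : ∀ t, 0 ≤ t → γ t ∈ s)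
    (hB : ∀ t, 0 ≤ t → ‖V (γ t)‖ ≤ B) (ha : ∀ n, 0 ≤ a n) (ha_lim : Tendsto a atTop (𝓝 0))
    (ha_sum : Tendsto (fun n => ∑ i ∈ Finset.range n, a i) atTop atTop)
    (hz : ∀ n, z (n + 1) = z n + a n • (V (z n) + e n)) (he : Tendsto e atTop (𝓝 0))
    (hzs : ∀ n, z n ∈ s) (hcl : MapClusterPt (γ 0) atTop z) {t : ℝ} (ht : 0 ≤ t) :
    MapClusterPt (γ t) atTop z := by
  refine Metric.nhds_basis_ball.mapClusterPt_iff_frequently.2 fun ε hε => ?_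
  have hB0 : 0 ≤ B := (norm_nonneg _).trans (hB 0 le_rfl)
  obtain ⟨ε', hε', hε'ε⟩ := exists_pos_mul_lt hε ((1 + t) * Real.exp (K * t) + 1)
  have hsmall : ∀ᶠ n in atTop, ‖e n‖ + K * (B * a n) < ε' ∧ B * a n < ε' := by
    refine (Tendsto.eventually_lt_const hε' ?_).and (Tendsto.eventually_lt_const hε' ?_)
    · simpa using he.norm.add ((ha_lim.const_mul B).const_mul (K : ℝ))
    · simpa using ha_lim.const_mul B
  obtain ⟨n₁, hn₁⟩ := eventually_atTop.1 hsmall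
  refine frequently_atTop.2 fun n₀ => ?_
  obtain ⟨n, hn, hzn⟩ := frequently_atTop.1
    (Metric.nhds_basis_ball.mapClusterPt_iff_frequently.1 hcl ε' hε') (max n₀ n₁)
  obtain ⟨hn₀, hn₁n⟩ := max_le_iff.1 hn
  obtain ⟨k, hTk, htk⟩ := exists_le_lt_succ_of_tendsto_atTop
    (tendsto_sum_range_add_atTop ha_sum n) (t := t) (by simpa)
  set T := ∑ i ∈ Finset.range k, a (n + i)
  have hT0 : 0 ≤ T := Finset.sum_nonneg fun i _ => ha _
  have htrack : ‖z (n + k) - γ T‖ ≤ (ε' + ε' * t) * Real.exp (K * t) := by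
    refine (norm_euler_sub_integralCurve_le (z := fun k => z (n + k)) hγ hV hγs hB
      (fun k => ha (n + k)) (fun k => hz (n + k)) (fun k => hzs (n + k))
      (fun k => (hn₁ (n + k) (by omega)).1.le) k).trans ?_
    gcongr
    exact (mem_ball_iff_norm.1 hzn).le
  have hmove : ‖γ t - γ T‖ ≤ ε' := by
    refine (norm_integralCurve_sub_le hγ hB hT0 ht).trans
      (le_trans ?_ (hn₁ (n + k) (by omega)).2.le)
    rw [abs_of_nonneg (by linarith)]
    gcongr
    linarith [Finset.sum_range_succ (fun i => a (n + i)) k]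
  refine ⟨n + k, by omega, mem_ball_iff_norm.2 ?_⟩
  calc ‖z (n + k) - γ t‖ ≤ ‖z (n + k) - γ T‖ + ‖γ t - γ T‖ := by
        rw [norm_sub_rev (γ t)]; exact norm_sub_le_norm_sub_add_norm_sub _ _ _
    _ ≤ (ε' + ε' * t) * Real.exp (K * t) + ε' := add_le_add htrack hmove
    _ = ((1 + t) * Real.exp (K * t) + 1) * ε' := by ring
    _ < ε := hε'ε

end IntegralCurve

/-! ### Basins of attraction -/

section Basin

/-- The domain of attraction of `xs` under `ẋ = V x`: the initial points of the solutions on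
`[0, ∞)` that converge to `xs`. It extends `domainOfAttraction` to an arbitrary vector field. -/
def basin {E : Type*} [NormedAddCommGroup E] [NormedSpace ℝ E] (V : E → E) (xs : E) : Set E :=
  {x₀ | ∃ γ : ℝ → E, IsIntegralCurveOn γ (fun _ => V) (Set.Ici 0) ∧ γ 0 = x₀ ∧
    Tendsto γ atTop (𝓝 xs)}

variable {E : Type*} [NormedAddCommGroup E]

theorem exists_forall_nonneg_norm_le_of_tendsto {γ : ℝ → E} {x : E}
    (hγ : ContinuousOn γ (Set.Ici 0)) (hlim : Tendsto γ atTop (𝓝 x)) :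
    ∃ R, ∀ t, 0 ≤ t → ‖γ t‖ ≤ R := by
  obtain ⟨T, hT⟩ := eventually_atTop.1 (hlim.norm.eventually_le_const (lt_add_one ‖x‖))
  obtain ⟨C, hC⟩ := (isCompact_Icc (a := (0 : ℝ)) (b := T)).exists_bound_of_continuousOn
    (hγ.mono Set.Icc_subset_Ici_self)
  refine ⟨max C (‖x‖ + 1), fun t ht => ?_⟩
  rcases le_total t T with htT | hTt
  · exact (hC t ⟨ht, htT⟩).trans (le_max_left _ _)
  · exact (hT t hTt).trans (le_max_right _ _)

theorem integralCurve_eq_of_eq_zero [NormedSpace ℝ E] {V : E → E} {γ : ℝ → E}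
    (hV : LocallyLipschitz V) (hγ : IsIntegralCurveOn γ (fun _ => V) (Set.Ici 0))
    (h0 : V (γ 0) = 0) {t : ℝ} (ht : 0 ≤ t) : γ t = γ 0 := by
  have hcont : ContinuousOn γ (Set.Icc 0 t) := hγ.continuousOn.mono Set.Icc_subset_Ici_self
  obtain ⟨K, hK⟩ :=
    (hV.locallyLipschitzOn (s := γ '' Set.Icc 0 t)).exists_lipschitzOnWith_of_compact
      (isCompact_Icc.image_of_continuousOn hcont)
  refine ODE_solution_unique_of_mem_Icc_right (v := fun _ => V) (fun _ _ => hK) hcont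
    (fun r hr => (hγ r hr.1).mono (Set.Ici_subset_Ici.2 hr.1))
    (fun r hr => Set.mem_image_of_mem γ (Set.Ico_subset_Icc_self hr)) continuousOn_const
    (fun r _ => ?_) (fun _ _ => Set.mem_image_of_mem γ (Set.left_mem_Icc.2 ht)) rfl
    (Set.right_mem_Icc.2 ht)
  simpa only [h0] using hasDerivWithinAt_const r (Set.Ici r) (γ 0)

theorem eq_of_mem_basin_of_eq_zero [NormedSpace ℝ E] {V : E → E} {xs y : E}
    (hV : LocallyLipschitz V) (hy : y ∈ basin V xs) (h0 : V y = 0) : y = xs := by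
  obtain ⟨γ, hγ, rfl, hlim⟩ := hy
  refine tendsto_nhds_unique (tendsto_const_nhds.congr' ?_) hlim
  filter_upwards [eventually_ge_atTop 0] with t ht
    using (integralCurve_eq_of_eq_zero hV hγ h0 ht).symm

end Basin

/-! ### Gradients and gradient flows -/

section Gradient

variable {E : Type*} [NormedAddCommGroup E] [InnerProductSpace ℝ E] [CompleteSpace E] {f : E → ℝ}

theorem contDiff_gradient (hf : ContDiff ℝ 2 f) : ContDiff ℝ 1 (gradient f) :=
  (InnerProductSpace.toDual ℝ E).symm.contDiff.comp (hf.fderiv_right (m := 1) (by norm_num))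

theorem exists_lipschitzOnWith_neg_gradient (hf : ContDiff ℝ 2 f) {s : Set E} (hs : IsCompact s) :
    ∃ K, LipschitzOnWith K (fun x => -gradient f x) s :=
  ((contDiff_gradient hf).neg.locallyLipschitz.locallyLipschitzOn).exists_lipschitzOnWith_of_compact
    hs

theorem abs_sub_sub_inner_gradient_le (hf : Differentiable ℝ f) {s : Set E} (hs : Convex ℝ s)
    {K : NNReal} (hK : LipschitzOnWith K (fun x => -gradient f x) s) {x y : E} (hx : x ∈ s)
    (hy : y ∈ s) : |f y - f x - inner ℝ (gradient f x) (y - x)| ≤ K * ‖y - x‖ ^ 2 := by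
  have hderiv : ∀ w ∈ segment ℝ x y, ‖fderiv ℝ f w - fderiv ℝ f x‖ ≤ K * ‖y - x‖ := fun w hw => by
    have hlip := hK.norm_sub_le hx (hs.segment_subset hx hy hw)
    have hdual : ‖fderiv ℝ f w - fderiv ℝ f x‖ = ‖gradient f w - gradient f x‖ := by
      simp only [gradient, ← map_sub, LinearIsometryEquiv.norm_map]
    rw [neg_sub_neg, norm_sub_rev x w] at hlip
    rw [hdual]
    refine hlip.trans ?_
    gcongr
    exact norm_sub_le_of_mem_segment hw
  have hmean := (convex_segment x y).norm_image_sub_le_of_norm_hasFDerivWithin_le'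
    (fun w _ => (hf w).hasFDerivAt.hasFDerivWithinAt) hderiv (left_mem_segment ℝ x y)
    (right_mem_segment ℝ x y)
  rw [gradient, InnerProductSpace.toDual_symm_apply, ← Real.norm_eq_abs, sq, ← mul_assoc]
  exact hmean

variable {γ : ℝ → E} {xs y : E}

theorem hasDerivWithinAt_comp_gradientFlow (hf : Differentiable ℝ f)
    (hγ : IsIntegralCurveOn γ (fun _ x => -gradient f x) (Set.Ici 0)) {t : ℝ} (ht : 0 ≤ t) :
    HasDerivWithinAt (fun s => f (γ s)) (-‖gradient f (γ t)‖ ^ 2) (Set.Ici 0) t := by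
  have hcomp := (hf (γ t)).hasFDerivAt.comp_hasDerivWithinAt t (hγ t ht)
  rwa [map_neg, ← InnerProductSpace.toDual_symm_apply, ← gradient,
    real_inner_self_eq_norm_sq] at hcomp

theorem antitoneOn_comp_gradientFlow (hf : Differentiable ℝ f)
    (hγ : IsIntegralCurveOn γ (fun _ x => -gradient f x) (Set.Ici 0)) :
    AntitoneOn (fun s => f (γ s)) (Set.Ici 0) := by
  have hderiv : ∀ t ∈ interior (Set.Ici (0 : ℝ)),
      HasDerivAt (fun s => f (γ s)) (-‖gradient f (γ t)‖ ^ 2) t := fun t ht =>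
    (hasDerivWithinAt_comp_gradientFlow hf hγ (interior_subset ht)).hasDerivAt
      (mem_interior_iff_mem_nhds.1 ht)
  refine antitoneOn_of_deriv_nonpos (convex_Ici 0)
    (hf.continuous.comp_continuousOn hγ.continuousOn)
    (fun t ht => (hderiv t ht).differentiableAt.differentiableWithinAt) fun t ht => ?_
  simp [(hderiv t ht).deriv]

/-- If `f` took the same value at `y` as at `xs`, it would be constant along the flow line of `y`,
so that `y` would be a critical point. -/
theorem lt_of_mem_basin (hf : ContDiff ℝ 2 f) (hy : y ∈ basin (fun x => -gradient f x) xs)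
    (hne : y ≠ xs) : f xs < f y := by
  have hbasin := hy
  obtain ⟨γ, hγ, rfl, hlim⟩ := hy
  have hfd : Differentiable ℝ f := hf.differentiable (by norm_num)
  have hle : ∀ t, 0 ≤ t → f xs ≤ f (γ t) := fun t ht => by
    refine le_of_tendsto ((hfd.continuous.tendsto _).comp hlim) ?_
    filter_upwards [eventually_ge_atTop t] with r hr
    exact antitoneOn_comp_gradientFlow hfd hγ ht (ht.trans hr) hr
  refine lt_of_le_of_ne (hle 0 le_rfl) fun heq => hne ?_
  have hconst : ∀ t ∈ Set.Ici (0 : ℝ), f (γ t) = f (γ 0) := fun t ht =>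
    le_antisymm (antitoneOn_comp_gradientFlow hfd hγ (Set.self_mem_Ici) ht ht) (heq ▸ hle t ht)
  have hzero : -‖gradient f (γ 0)‖ ^ 2 = 0 :=
    (uniqueDiffOn_Ici 0 0 Set.self_mem_Ici).eq_deriv _
      (hasDerivWithinAt_comp_gradientFlow hfd hγ le_rfl)
      ((hasDerivWithinAt_const 0 _ (f (γ 0))).congr hconst rfl)
  exact eq_of_mem_basin_of_eq_zero (contDiff_gradient hf).neg.locallyLipschitz hbasin
    (by simpa using hzero)

theorem gradient_ne_zero_of_mem_basin (hf : ContDiff ℝ 2 f)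
    (hy : y ∈ basin (fun x => -gradient f x) xs) (hne : y ≠ xs) : gradient f y ≠ 0 := fun h0 =>
  hne (eq_of_mem_basin_of_eq_zero (contDiff_gradient hf).neg.locallyLipschitz hy (by simp [h0]))

end Gradient

/-! ### Convergence of perturbed gradient descent -/

section Lyapunov

theorem eventually_of_frequently_of_succ {p : ℕ → Prop} (hfreq : ∃ᶠ n in atTop, p n)
    (hsucc : ∀ᶠ n in atTop, p n → p (n + 1)) : ∀ᶠ n in atTop, p n := by
  obtain ⟨n₀, hn₀⟩ := eventually_atTop.1 hsucc
  obtain ⟨n₁, hn₁, hp⟩ := frequently_atTop.1 hfreq n₀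
  exact eventually_atTop.2 ⟨n₁, Nat.le_induction hp fun n hn => hn₀ n (hn₁.trans hn)⟩

variable {X : Type*} [PseudoMetricSpace X] [ProperSpace X] {f G : X → ℝ} {xs : X} {z : ℕ → X}
  {a κ : ℕ → ℝ}

/-- Below a level `u` which `f` exceeds on the annulus `ε / 2 ≤ dist y xs ≤ ε`, the ball of radius
`ε / 2` is a trap: short steps do not cross the annulus, and the value `u` cannot be exceeded since
`f` strictly decreases close to the level `u`. -/
theorem eventually_trap_succ (hf : Continuous f) (hG : Continuous G) (hG0 : ∀ y, 0 ≤ G y)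
    (ha : ∀ n, 0 ≤ a n) (ha_lim : Tendsto a atTop (𝓝 0)) (hκ : Tendsto κ atTop (𝓝 0))
    (hdist : Tendsto (fun n => dist (z (n + 1)) (z n)) atTop (𝓝 0))
    (hdesc : ∀ n, f (z (n + 1)) ≤ f (z n) - a n * (G (z n) - κ n)) {ε u : ℝ} (hε : 0 < ε)
    (hfε : f xs < u) (hGε : ∀ y, dist y xs ≤ ε → f y ≠ f xs → 0 < G y)
    (hu : ∀ y, dist y xs ≤ ε → ε / 2 ≤ dist y xs → u ≤ f y) :
    ∀ᶠ n in atTop, dist (z n) xs < ε / 2 ∧ f (z n) < u →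
      dist (z (n + 1)) xs < ε / 2 ∧ f (z (n + 1)) < u := by
  obtain ⟨v, hxsv, hvu⟩ := exists_between hfε
  obtain ⟨c, hc, hcG⟩ : ∃ c, 0 < c ∧ ∀ y ∈ Metric.closedBall xs ε ∩ {y | v ≤ f y}, c ≤ G y :=
    ((isCompact_closedBall xs ε).inter_right (isClosed_le continuous_const hf)).exists_forall_le'
      hG.continuousOn fun y hy => hGε y hy.1 (hxsv.trans_le hy.2).ne'
  have haκ : Tendsto (fun n => a n * κ n) atTop (𝓝 0) := by simpa using ha_lim.mul hκ
  filter_upwards [hdist.eventually_lt_const (half_pos hε), hκ.eventually_le_const hc,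
    haκ.eventually_lt_const (sub_pos.2 hvu)] with n hstep hκc haκn ⟨hzε, hzu⟩
  have hnext : f (z (n + 1)) < u := by
    rcases le_or_gt v (f (z n)) with hv | hv
    · have hG := hcG (z n) ⟨Metric.mem_closedBall.2 (by linarith), hv⟩
      nlinarith [hdesc n, mul_nonneg (ha n) (sub_nonneg.2 (hκc.trans hG))]
    · nlinarith [hdesc n, mul_nonneg (ha n) (hG0 (z n))]
  refine ⟨not_le.1 fun hfar => hnext.not_ge (hu _ ?_ hfar), hnext⟩
  linarith [dist_triangle (z (n + 1)) (z n) xs]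

theorem tendsto_of_mapClusterPt_of_lyapunov (hf : Continuous f) (hG : Continuous G)
    (hG0 : ∀ y, 0 ≤ G y) (hmin : ∀ᶠ y in 𝓝 xs, y ≠ xs → f xs < f y ∧ 0 < G y)
    (ha : ∀ n, 0 ≤ a n) (ha_lim : Tendsto a atTop (𝓝 0)) (hκ : Tendsto κ atTop (𝓝 0))
    (hdist : Tendsto (fun n => dist (z (n + 1)) (z n)) atTop (𝓝 0))
    (hdesc : ∀ n, f (z (n + 1)) ≤ f (z n) - a n * (G (z n) - κ n))
    (hcl : MapClusterPt xs atTop z) : Tendsto z atTop (𝓝 xs) := by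
  obtain ⟨r, hr, hball⟩ := Metric.nhds_basis_closedBall.eventually_iff.1 hmin
  refine Metric.tendsto_atTop'.2 fun ε' hε' => ?_
  set ε := min r ε'
  have hε : 0 < ε := lt_min hr hε'
  have hεr : ∀ {y}, dist y xs ≤ ε → y ∈ Metric.closedBall xs r := fun hy =>
    Metric.mem_closedBall.2 (hy.trans (min_le_left _ _))
  have hannulus : IsCompact (Metric.closedBall xs ε ∩ {y | ε / 2 ≤ dist y xs}) :=
    (isCompact_closedBall xs ε).inter_right
      (isClosed_le continuous_const (continuous_id.dist continuous_const))
  obtain ⟨u, hxsu, hu⟩ := hannulus.exists_forall_le' (a := f xs) hf.continuousOn fun y hy =>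
    (hball (hεr hy.1) fun h => by have := hy.2.out; simp [h] at this; linarith).1
  have htrap := eventually_trap_succ hf hG hG0 ha ha_lim hκ hdist hdesc hε hxsu
    (fun y hy hne => (hball (hεr hy) (ne_of_apply_ne f hne)).2) (fun y hy hy' => hu y ⟨hy, hy'⟩)
  have hvisit : ∃ᶠ n in atTop, dist (z n) xs < ε / 2 ∧ f (z n) < u :=
    hcl.frequently ((Metric.eventually_nhds_iff_ball.2 ⟨ε / 2, half_pos hε, fun y => id⟩).and
      (hf.continuousAt.eventually_lt_const hxsu))
  obtain ⟨n₀, hn₀⟩ := eventually_atTop.1 (eventually_of_frequently_of_succ hvisit htrap)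
  exact ⟨n₀, fun n hn => (hn₀ n hn.le).1.trans ((half_lt_self hε).trans_le (min_le_right _ _))⟩

end Lyapunov

section Descent

theorem mapClusterPt_add_of_tendsto_zero {M : Type*} [TopologicalSpace M]
    [FirstCountableTopology M] [AddMonoid M] [ContinuousAdd M] {x u : ℕ → M} {y : M}
    (hx : MapClusterPt y atTop x) (hu : Tendsto u atTop (𝓝 0)) : MapClusterPt y atTop (x + u) := by
  obtain ⟨φ, hφ, hlim⟩ := hx.tendsto_subseq
  refine MapClusterPt.of_comp hφ.tendsto_atTop (Tendsto.mapClusterPt ?_)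
  rw [← add_zero y]
  exact hlim.add (hu.comp hφ.tendsto_atTop)

variable {E : Type*} [NormedAddCommGroup E] [InnerProductSpace ℝ E] {f : E → ℝ} {s : Set E}
  {K : NNReal}

theorem descent_step [CompleteSpace E] (hf : Differentiable ℝ f) (hs : Convex ℝ s)
    (hK : LipschitzOnWith K (fun x => -gradient f x) s) {x w : E} {h : ℝ} (hh : 0 ≤ h)
    (hx : x ∈ s) (hx' : x + h • (-gradient f x + w) ∈ s) :
    f (x + h • (-gradient f x + w)) ≤ f x - h * (‖gradient f x‖ ^ 2 -
      (‖gradient f x‖ * ‖w‖ + K * h * (‖gradient f x‖ + ‖w‖) ^ 2)) := by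
  have htaylor := (abs_le.1 (abs_sub_sub_inner_gradient_le hf hs hK hx hx')).2
  rw [add_sub_cancel_left, norm_smul_of_nonneg hh, inner_smul_right, inner_add_right,
    inner_neg_right, real_inner_self_eq_norm_sq] at htaylor
  have hcross : h * inner ℝ (gradient f x) w ≤ h * (‖gradient f x‖ * ‖w‖) := by
    gcongr
    exact real_inner_le_norm _ _
  have hquad : K * (h * ‖-gradient f x + w‖) ^ 2 ≤ K * (h * (‖gradient f x‖ + ‖w‖)) ^ 2 := by
    gcongr
    exact (norm_add_le _ _).trans_eq (by rw [norm_neg])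
  linarith

variable [FiniteDimensional ℝ E] {xs : E} {a : ℕ → ℝ}

theorem exists_tendsto_zero_descent (hf : ContDiff ℝ 2 f) (ha : ∀ n, 0 ≤ a n)
    (ha_lim : Tendsto a atTop (𝓝 0)) {z e : ℕ → E}
    (hz : ∀ n, z (n + 1) = z n + a n • (-gradient f (z n) + e n)) (he : Tendsto e atTop (𝓝 0))
    {R : ℝ} (hzR : ∀ n, ‖z n‖ ≤ R) :
    (∃ κ : ℕ → ℝ, Tendsto κ atTop (𝓝 0) ∧
      ∀ n, f (z (n + 1)) ≤ f (z n) - a n * (‖gradient f (z n)‖ ^ 2 - κ n)) ∧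
    Tendsto (fun n => dist (z (n + 1)) (z n)) atTop (𝓝 0) := by
  have hzmem : ∀ n, z n ∈ Metric.closedBall 0 R := fun n => mem_closedBall_zero_iff.2 (hzR n)
  obtain ⟨K, hK⟩ := exists_lipschitzOnWith_neg_gradient hf (isCompact_closedBall (0 : E) R)
  obtain ⟨B, hB⟩ := (isCompact_closedBall (0 : E) R).exists_bound_of_continuousOn
    (contDiff_gradient hf).continuous.continuousOn
  have hBz : ∀ n, ‖gradient f (z n)‖ ≤ B := fun n => hB _ (hzmem n)
  have hstep : Tendsto (fun n => a n * (B + ‖e n‖)) atTop (𝓝 0) := by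
    simpa using ha_lim.mul (he.norm.const_add B)
  refine ⟨⟨fun n => B * ‖e n‖ + K * a n * (B + ‖e n‖) ^ 2, ?_, fun n => ?_⟩, ?_⟩
  · simpa using (he.norm.const_mul B).add
      ((ha_lim.const_mul (K : ℝ)).mul ((he.norm.const_add B).pow 2))
  · rw [hz]
    refine (descent_step (hf.differentiable (by norm_num)) (convex_closedBall 0 R) hK (ha n)
      (hzmem n) (hz n ▸ hzmem (n + 1))).trans ?_
    have := ha n
    dsimp only
    gcongr <;> exact hBz n
  · refine squeeze_zero (fun _ => dist_nonneg) (fun n => ?_) hstep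
    rw [hz, dist_self_add_left, norm_smul_of_nonneg (ha n)]
    refine mul_le_mul_of_nonneg_left ((norm_add_le _ _).trans ?_) (ha n)
    rw [norm_neg]
    gcongr
    exact hBz n

theorem tendsto_of_mapClusterPt_basin (hf : ContDiff ℝ 2 f)
    (hxs : basin (fun x => -gradient f x) xs ∈ 𝓝 xs) (ha : ∀ n, 0 ≤ a n)
    (ha_lim : Tendsto a atTop (𝓝 0))
    (ha_sum : Tendsto (fun n => ∑ i ∈ Finset.range n, a i) atTop atTop) {z e : ℕ → E}
    (hz : ∀ n, z (n + 1) = z n + a n • (-gradient f (z n) + e n)) (he : Tendsto e atTop (𝓝 0))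
    {R : ℝ} (hzR : ∀ n, ‖z n‖ ≤ R) {y : E} (hy : y ∈ basin (fun x => -gradient f x) xs)
    (hcl : MapClusterPt y atTop z) : Tendsto z atTop (𝓝 xs) := by
  obtain ⟨⟨κ, hκ, hdesc⟩, hdist⟩ := exists_tendsto_zero_descent hf ha ha_lim hz he hzR
  have hgrad := (contDiff_gradient hf).continuous
  refine tendsto_of_mapClusterPt_of_lyapunov hf.continuous (hgrad.norm.pow 2)
    (fun _ => sq_nonneg _) ?_ ha ha_lim hκ hdist hdesc ?_
  · filter_upwards [hxs] with w hw hne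
    exact ⟨lt_of_mem_basin hf hw hne,
      pow_pos (norm_pos_iff.2 (gradient_ne_zero_of_mem_basin hf hw hne)) 2⟩
  obtain ⟨γ, hγ, rfl, hlim⟩ := hy
  obtain ⟨R', hγR'⟩ := exists_forall_nonneg_norm_le_of_tendsto hγ.continuousOn hlim
  have hball := isCompact_closedBall (0 : E) (max R R')
  obtain ⟨K, hK⟩ := exists_lipschitzOnWith_neg_gradient hf hball
  obtain ⟨B, hB⟩ := hball.exists_bound_of_continuousOn hgrad.neg.continuousOn
  have hγball : ∀ t, 0 ≤ t → γ t ∈ Metric.closedBall 0 (max R R') := fun t ht =>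
    mem_closedBall_zero_iff.2 ((hγR' t ht).trans (le_max_right _ _))
  have hzball : ∀ n, z n ∈ Metric.closedBall 0 (max R R') := fun n =>
    mem_closedBall_zero_iff.2 ((hzR n).trans (le_max_left _ _))
  have hγcl : ∀ t, 0 ≤ t → MapClusterPt (γ t) atTop z := fun t ht =>
    mapClusterPt_integralCurve hγ hK hγball (fun t ht => hB _ (hγball t ht)) ha ha_lim ha_sum hz he
      hzball hcl ht
  exact isClosed_setOfPred_clusterPt.mem_of_tendsto hlim
    (by filter_upwards [eventually_ge_atTop 0] with t ht using hγcl t ht)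

/-- Shifting `x n` by the tail `∑_{k ≥ n} w k` of the noise turns the recursion into a perturbed
gradient descent whose perturbation tends to `0`. -/
theorem tendsto_of_mapClusterPt_basin_of_summable_noise (hf : ContDiff ℝ 2 f)
    (hxs : basin (fun x => -gradient f x) xs ∈ 𝓝 xs) (ha : ∀ n, 0 ≤ a n)
    (ha_lim : Tendsto a atTop (𝓝 0))
    (ha_sum : Tendsto (fun n => ∑ i ∈ Finset.range n, a i) atTop atTop) {x b w : ℕ → E}
    (hx : ∀ n, x (n + 1) = x n + a n • (-gradient f (x n) + b n) + w n)
    (hb : Tendsto b atTop (𝓝 0)) {S : E}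
    (hw : Tendsto (fun n => ∑ k ∈ Finset.range n, w k) atTop (𝓝 S)) {R : ℝ}
    (hxR : ∀ n, ‖x n‖ ≤ R) {y : E} (hy : y ∈ basin (fun x => -gradient f x) xs)
    (hcl : MapClusterPt y atTop x) : Tendsto x atTop (𝓝 xs) := by
  set tail : ℕ → E := fun n => S - ∑ k ∈ Finset.range n, w k with htail
  have htail0 : Tendsto tail atTop (𝓝 0) := by simpa using hw.const_sub S
  obtain ⟨C, hC⟩ := htail0.norm.bddAbove_range
  have htailC : ∀ n, ‖tail n‖ ≤ C := fun n => hC ⟨n, rfl⟩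
  have hzR : ∀ n, ‖(x + tail) n‖ ≤ R + C := fun n =>
    (norm_add_le _ _).trans (add_le_add (hxR n) (htailC n))
  have hxRC : ∀ n, ‖x n‖ ≤ R + C := fun n => by
    linarith [hxR n, (norm_nonneg _).trans (htailC n)]
  obtain ⟨K, hK⟩ := exists_lipschitzOnWith_neg_gradient hf (isCompact_closedBall (0 : E) (R + C))
  have hgrad : Tendsto (fun n => gradient f ((x + tail) n) - gradient f (x n)) atTop (𝓝 0) := by
    refine squeeze_zero_norm (a := fun n => K * ‖tail n‖) (fun n => ?_)
      (by simpa using htail0.norm.const_mul (K : ℝ))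
    have hlip := hK.norm_sub_le (mem_closedBall_zero_iff.2 (hxRC n))
      (mem_closedBall_zero_iff.2 (hzR n))
    simpa [neg_add_eq_sub] using hlip
  suffices hz : Tendsto (x + tail) atTop (𝓝 xs) by
    simpa using hz.sub htail0
  refine tendsto_of_mapClusterPt_basin hf hxs ha ha_lim ha_sum (fun n => ?_)
    (by simpa using hgrad.add hb) hzR hy (mapClusterPt_add_of_tendsto_zero hcl htail0)
  simp only [Pi.add_apply, htail, hx, Finset.sum_range_succ]
  module

end Descent

/-! ### Conditional expectations and square-integrable martingales -/

section CondExp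

variable {Ω E : Type*} {m m' m0 : MeasurableSpace Ω} {μ : Measure Ω}
  [NormedAddCommGroup E] [NormedSpace ℝ E] [CompleteSpace E]

theorem condDistrib_ae_eq_const_of_indepFun [IsProbabilityMeasure μ] {V W : Type*}
    [MeasurableSpace V] [StandardBorelSpace V] [Nonempty V] [MeasurableSpace W]
    {X : Ω → W} {D : Ω → V}
    (hX : AEMeasurable X μ) (hD : AEMeasurable D μ) (hind : IndepFun X D μ) :
    condDistrib D X μ =ᵐ[μ.map X] Kernel.const W (μ.map D) := by
  have := Measure.isProbabilityMeasure_map hX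
  have := Measure.isProbabilityMeasure_map hD
  refine condDistrib_ae_eq_of_measure_eq_compProd X hD ?_
  rw [Measure.compProd_const, (indepFun_iff_map_prod_eq_prod_map_map hX hD).1 hind]

theorem condExp_comap_prod_ae_eq_integral_of_indepFun [IsProbabilityMeasure μ] {V W : Type*}
    [MeasurableSpace V] [StandardBorelSpace V] [Nonempty V]
    {mW : MeasurableSpace W} {X : Ω → W} {D : Ω → V}
    (hX : Measurable X) (hD : Measurable D) (hind : IndepFun X D μ) {h : W × V → E}
    (hh : StronglyMeasurable h) (hint : Integrable (fun ω => h (X ω, D ω)) μ) :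
    μ[fun ω => h (X ω, D ω) | mW.comap X] =ᵐ[μ]
      fun ω => ∫ ω', h (X ω, D ω') ∂μ := by
  have hconst := ae_of_ae_map hX.aemeasurable
    (condDistrib_ae_eq_const_of_indepFun hX.aemeasurable hD.aemeasurable hind)
  filter_upwards [condExp_prod_ae_eq_integral_condDistrib hX hD.aemeasurable hh hint, hconst]
    with ω hω hωconst
  rw [hω, hωconst, Kernel.const_apply, integral_map hD.aemeasurable]
  exact (hh.comp_measurable measurable_prodMk_left).aestronglyMeasurable

theorem condExp_ae_eq_integral_of_indep [IsProbabilityMeasure μ] {V W : Type*}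
    [MeasurableSpace V] [StandardBorelSpace V] [Nonempty V] [MeasurableSpace W]
    (hm : m ≤ m0) {X : Ω → W} {D : Ω → V}
    (hX : Measurable[m] X) (hD : Measurable D)
    (hind : Indep (MeasurableSpace.comap D inferInstance) m μ) {h : W × V → E}
    (hh : StronglyMeasurable h) (hint : Integrable (fun ω => h (X ω, D ω)) μ) :
    μ[fun ω => h (X ω, D ω) | m] =ᵐ[μ] fun ω => ∫ ω', h (X ω, D ω') ∂μ := by
  have hid : @Measurable Ω Ω m0 m id := fun s hs => hm s hs
  have hindFun : @IndepFun Ω Ω V m0 m _ id D μ :=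
    (@IndepFun_iff_Indep Ω Ω V m0 m _ id D μ).2 (by rw [MeasurableSpace.comap_id]; exact hind.symm)
  have hXD : Measurable[m.prod inferInstance] (Prod.map X (id : V → V)) :=
    hX.prodMap measurable_id
  have hcond := condExp_comap_prod_ae_eq_integral_of_indepFun (mW := m) hid hD hindFun
    (hh.comp_measurable hXD) hint
  rwa [MeasurableSpace.comap_id] at hcond

theorem condExp_smul_eq_zero [IsFiniteMeasure μ] (hmm' : m ≤ m') (hm' : m' ≤ m0)
    {ξ : Ω → ℝ} {D : Ω → E}
    (hD : AEStronglyMeasurable[m'] D μ) (hξ : Integrable ξ μ) (hξD : Integrable (ξ • D) μ)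
    (hξ0 : μ[ξ | m'] =ᵐ[μ] 0) : μ[ξ • D | m] =ᵐ[μ] 0 := by
  have hzero : μ[ξ • D | m'] =ᵐ[μ] 0 := by
    filter_upwards [condExp_smul_of_aestronglyMeasurable_right hξ hξD hD, hξ0] with ω hω hω0
    simp [hω, hω0]
  refine (condExp_condExp_of_le hmm' hm').symm.trans ((condExp_congr_ae hzero).trans ?_)
  rw [condExp_zero]

theorem condExp_sub_condExp_ae_eq_zero [IsFiniteMeasure μ]
    (hm : m ≤ m0) {Y : Ω → E} (hY : Integrable Y μ) : μ[Y - μ[Y | m] | m] =ᵐ[μ] 0 := by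
  refine (condExp_sub hY integrable_condExp m).trans ?_
  rw [condExp_of_stronglyMeasurable hm stronglyMeasurable_condExp integrable_condExp, sub_self]

end CondExp

section Martingale

variable {Ω : Type*} {m0 : MeasurableSpace Ω} {μ : Measure Ω} {ℱ : Filtration ℕ m0}

theorem integral_mul_eq_zero_of_condExp_eq_zero {m : MeasurableSpace Ω} [IsFiniteMeasure μ]
    (hm : m ≤ m0) {X Y : Ω → ℝ} (hXm : StronglyMeasurable[m] X) (hX : MemLp X 2 μ)
    (hY : MemLp Y 2 μ) (hY0 : μ[Y | m] =ᵐ[μ] 0) : ∫ ω, X ω * Y ω ∂μ = 0 := by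
  have hXY : μ[X * Y | m] =ᵐ[μ] 0 := by
    filter_upwards [condExp_mul_of_stronglyMeasurable_left hXm (hX.integrable_mul hY)
      (hY.integrable one_le_two), hY0] with ω hω hω0
    simp [hω, hω0]
  calc ∫ ω, X ω * Y ω ∂μ = ∫ ω, (μ[X * Y | m]) ω ∂μ := (integral_condExp hm).symm
    _ = 0 := by rw [integral_congr_ae hXY]; simp

theorem integral_add_sq_of_integral_mul_eq_zero {X Y : Ω → ℝ} (hX : MemLp X 2 μ)
    (hY : MemLp Y 2 μ) (hXY : ∫ ω, X ω * Y ω ∂μ = 0) :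
    ∫ ω, (X ω + Y ω) ^ 2 ∂μ = ∫ ω, X ω ^ 2 ∂μ + ∫ ω, Y ω ^ 2 ∂μ := by
  have hcross : Integrable (fun ω => 2 * (X ω * Y ω)) μ := (hX.integrable_mul hY).const_mul 2
  simp only [add_sq, mul_assoc]
  rw [integral_add (f := fun ω => X ω ^ 2 + 2 * (X ω * Y ω)) (hX.integrable_sq.add hcross)
      hY.integrable_sq,
    integral_add hX.integrable_sq hcross, integral_const_mul, hXY, mul_zero, add_zero]

theorem integral_sum_sq_eq_of_condExp_eq_zero [IsFiniteMeasure μ] {M : ℕ → Ω → ℝ}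
    (hM : ∀ k, StronglyMeasurable[ℱ (k + 1)] (M k)) (hM2 : ∀ k, MemLp (M k) 2 μ)
    (hM0 : ∀ k, μ[M k | ℱ k] =ᵐ[μ] 0) (n : ℕ) :
    ∫ ω, (∑ k ∈ Finset.range n, M k ω) ^ 2 ∂μ = ∑ k ∈ Finset.range n, ∫ ω, M k ω ^ 2 ∂μ := by
  induction n with
  | zero => simp
  | succ n ih =>
    have hSm : StronglyMeasurable[ℱ n] fun ω => ∑ k ∈ Finset.range n, M k ω :=
      Finset.stronglyMeasurable_fun_sum _ fun k hk => (hM k).mono (ℱ.mono (Finset.mem_range.1 hk))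
    have hS2 : MemLp (fun ω => ∑ k ∈ Finset.range n, M k ω) 2 μ :=
      memLp_finsetSum _ fun k _ => hM2 k
    have horth := integral_mul_eq_zero_of_condExp_eq_zero (ℱ.le n) hSm hS2 (hM2 n) (hM0 n)
    simp only [Finset.sum_range_succ]
    rw [integral_add_sq_of_integral_mul_eq_zero hS2 (hM2 n) horth, ih]

theorem martingale_sum_range_of_condExp_eq_zero [IsFiniteMeasure μ] {M : ℕ → Ω → ℝ}
    (hM : ∀ k, StronglyMeasurable[ℱ (k + 1)] (M k)) (hMi : ∀ k, Integrable (M k) μ)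
    (hM0 : ∀ k, μ[M k | ℱ k] =ᵐ[μ] 0) :
    Martingale (fun n => ∑ k ∈ Finset.range n, M k) ℱ μ := by
  refine martingale_of_condExp_sub_eq_zero_nat
    (fun n => Finset.stronglyMeasurable_sum _ fun k hk =>
      (hM k).mono (ℱ.mono (Finset.mem_range.1 hk)))
    (fun n => integrable_finsetSum' _ fun k _ => hMi k) fun n => ?_
  rw [Finset.sum_range_succ_sub_sum]
  exact hM0 n

theorem integral_norm_sq_eq_toReal_eLpNorm_sq {F : Type*} [NormedAddCommGroup F] {X : Ω → F}
    (hX : MemLp X 2 μ) : ∫ ω, ‖X ω‖ ^ 2 ∂μ = (eLpNorm X 2 μ).toReal ^ 2 := by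
  have h0 : 0 ≤ ∫ ω, ‖X ω‖ ^ 2 ∂μ := integral_nonneg fun ω => sq_nonneg _
  rw [hX.eLpNorm_eq_integral_rpow_norm two_ne_zero ENNReal.ofNat_ne_top]
  simp only [ENNReal.toReal_ofNat, Real.rpow_two]
  rw [ENNReal.toReal_ofReal (by positivity), ← Real.rpow_two, ← Real.rpow_mul h0]
  simp

theorem integral_norm_sub_condExp_sq_le {F : Type*} [NormedAddCommGroup F] [NormedSpace ℝ F]
    [CompleteSpace F] {m : MeasurableSpace Ω} {Y : Ω → F} {β : ℝ} (hY : MemLp Y 2 μ)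
    (hβ : 0 ≤ β) (hYβ : eLpNorm Y 2 μ ≤ ENNReal.ofReal β) :
    ∫ ω, ‖(Y - μ[Y | m]) ω‖ ^ 2 ∂μ ≤ 4 * β ^ 2 := by
  have hbound : eLpNorm (Y - μ[Y | m]) 2 μ ≤ ENNReal.ofReal (2 * β) := by
    calc eLpNorm (Y - μ[Y | m]) 2 μ
        ≤ eLpNorm Y 2 μ + eLpNorm (μ[Y | m]) 2 μ :=
          eLpNorm_sub_le hY.1 integrable_condExp.1 one_le_two
      _ ≤ ENNReal.ofReal β + ENNReal.ofReal β := by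
          gcongr
          exact (eLpNorm_condExp_le_eLpNorm Y one_le_two).trans hYβ
      _ = ENNReal.ofReal (2 * β) := by rw [← ENNReal.ofReal_add hβ hβ, two_mul]
  calc ∫ ω, ‖(Y - μ[Y | m]) ω‖ ^ 2 ∂μ = (eLpNorm (Y - μ[Y | m]) 2 μ).toReal ^ 2 :=
        integral_norm_sq_eq_toReal_eLpNorm_sq (hY.sub (hY.condExp one_le_two))
    _ ≤ (2 * β) ^ 2 := by
        gcongr
        exact ENNReal.toReal_le_of_le_ofReal (by positivity) hbound
    _ = 4 * β ^ 2 := by ring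

/-- The partial sums form a martingale that is bounded in `L²`, hence in `L¹`. -/
theorem ae_exists_tendsto_sum_real_of_condExp_eq_zero [IsProbabilityMeasure μ] {M : ℕ → Ω → ℝ}
    (hM : ∀ k, StronglyMeasurable[ℱ (k + 1)] (M k)) (hM2 : ∀ k, MemLp (M k) 2 μ)
    (hM0 : ∀ k, μ[M k | ℱ k] =ᵐ[μ] 0) (hsum : Summable fun k => ∫ ω, M k ω ^ 2 ∂μ) :
    ∀ᵐ ω ∂μ, ∃ S, Tendsto (fun n => ∑ k ∈ Finset.range n, M k ω) atTop (𝓝 S) := by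
  have hmart := martingale_sum_range_of_condExp_eq_zero hM
    (fun k => (hM2 k).integrable one_le_two) hM0
  set B : ℝ := ∑' k, ∫ ω, M k ω ^ 2 ∂μ
  have hbdd : ∀ n, eLpNorm (∑ k ∈ Finset.range n, M k) 1 μ ≤ (√B).toNNReal := fun n => by
    have hS2 : MemLp (∑ k ∈ Finset.range n, M k) 2 μ := memLp_finsetSum' _ fun k _ => hM2 k
    have hsq : (eLpNorm (∑ k ∈ Finset.range n, M k) 2 μ).toReal ^ 2 ≤ B := by
      calc (eLpNorm (∑ k ∈ Finset.range n, M k) 2 μ).toReal ^ 2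
          = ∫ ω, (∑ k ∈ Finset.range n, M k ω) ^ 2 ∂μ := by
            simp [← integral_norm_sq_eq_toReal_eLpNorm_sq hS2]
        _ = ∑ k ∈ Finset.range n, ∫ ω, M k ω ^ 2 ∂μ :=
            integral_sum_sq_eq_of_condExp_eq_zero hM hM2 hM0 n
        _ ≤ B := hsum.sum_le_tsum _ fun k _ => integral_nonneg fun ω => sq_nonneg _
    exact (eLpNorm_le_eLpNorm_of_exponent_le one_le_two hS2.1).trans
      ((ENNReal.le_ofReal_iff_toReal_le hS2.2.ne (Real.sqrt_nonneg B)).2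
        (Real.le_sqrt_of_sq_le hsq))
  filter_upwards [hmart.submartingale.exists_ae_tendsto_of_bdd hbdd] with ω hω
  simpa using hω

variable {E : Type*} [NormedAddCommGroup E] [InnerProductSpace ℝ E]

theorem exists_tendsto_of_forall_inner_orthonormalBasis {ι α : Type*} [Fintype ι]
    (b : OrthonormalBasis ι ℝ E) {l : Filter α} {u : α → E}
    (hu : ∀ i, ∃ S, Tendsto (fun n => inner ℝ (b i) (u n)) l (𝓝 S)) : ∃ S, Tendsto u l (𝓝 S) := by
  choose S hS using hu
  refine ⟨∑ i, S i • b i, ?_⟩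
  exact Tendsto.congr (fun n => b.sum_repr' (u n))
    (tendsto_finsetSum _ fun i _ => (hS i).smul_const (b i))

theorem ae_exists_tendsto_sum_of_condExp_eq_zero [FiniteDimensional ℝ E]
    [IsProbabilityMeasure μ] {M : ℕ → Ω → E}
    (hM : ∀ k, StronglyMeasurable[ℱ (k + 1)] (M k)) (hM2 : ∀ k, MemLp (M k) 2 μ)
    (hM0 : ∀ k, μ[M k | ℱ k] =ᵐ[μ] 0) (hsum : Summable fun k => ∫ ω, ‖M k ω‖ ^ 2 ∂μ) :
    ∀ᵐ ω ∂μ, ∃ S, Tendsto (fun n => ∑ k ∈ Finset.range n, M k ω) atTop (𝓝 S) := by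
  set b := stdOrthonormalBasis ℝ E
  have hcoord : ∀ i, ∀ᵐ ω ∂μ, ∃ S,
      Tendsto (fun n => ∑ k ∈ Finset.range n, inner ℝ (b i) (M k ω)) atTop (𝓝 S) := fun i => by
    have hb2 : ∀ k, MemLp (fun ω => inner ℝ (b i) (M k ω)) 2 μ := fun k => (hM2 k).const_inner _
    refine ae_exists_tendsto_sum_real_of_condExp_eq_zero (ℱ := ℱ)
      (fun k => (innerSL ℝ (b i)).continuous.comp_stronglyMeasurable (hM k)) hb2 (fun k => ?_) ?_
    · filter_upwards [(innerSL ℝ (b i)).comp_condExp_comm (m := ℱ k)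
        ((hM2 k).integrable one_le_two), hM0 k] with ω hω hω0
      rw [Function.comp_apply, hω0, Pi.zero_apply, map_zero] at hω
      exact hω.symm
    · refine hsum.of_nonneg_of_le (fun k => integral_nonneg fun ω => sq_nonneg _) fun k =>
        integral_mono (hb2 k).integrable_sq ((hM2 k).integrable_norm_pow two_ne_zero) fun ω => ?_
      have := abs_real_inner_le_norm (b i) (M k ω)
      rw [b.norm_eq_one, one_mul] at this
      exact sq_le_sq' (neg_le_of_abs_le this) (le_of_abs_le this)
  filter_upwards [ae_all_iff.2 hcoord] with ω hω
  exact exists_tendsto_of_forall_inner_orthonormalBasis b (by simpa only [inner_sum] using hω)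

theorem ae_exists_tendsto_sum_sub_condExp [FiniteDimensional ℝ E] [IsProbabilityMeasure μ]
    {Y : ℕ → Ω → E} (hY : ∀ n, StronglyMeasurable[ℱ (n + 1)] (Y n)) {β : ℕ → ℝ}
    (hβ : ∀ n, 0 ≤ β n) (hYβ : ∀ n, eLpNorm (Y n) 2 μ ≤ ENNReal.ofReal (β n))
    (hsum : Summable fun n => β n ^ 2) :
    ∀ᵐ ω ∂μ, ∃ S, Tendsto
      (fun n => ∑ k ∈ Finset.range n, (Y k - μ[Y k | ℱ k]) ω) atTop (𝓝 S) := by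
  have hY2 : ∀ n, MemLp (Y n) 2 μ := fun n =>
    ⟨((hY n).mono (ℱ.le _)).aestronglyMeasurable, (hYβ n).trans_lt ENNReal.ofReal_lt_top⟩
  exact ae_exists_tendsto_sum_of_condExp_eq_zero
    (fun n => (hY n).sub (stronglyMeasurable_condExp.mono (ℱ.mono n.le_succ)))
    (fun n => (hY2 n).sub ((hY2 n).condExp one_le_two))
    (fun n => condExp_sub_condExp_ae_eq_zero (ℱ.le n) ((hY2 n).integrable one_le_two))
    ((hsum.mul_left 4).of_nonneg_of_le (fun n => integral_nonneg fun ω => sq_nonneg _)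
      fun n => integral_norm_sub_condExp_sq_le (hY2 n) (hβ n) (hYβ n))

theorem ae_tendsto_of_condExp_increment_eq [FiniteDimensional ℝ E] [MeasurableSpace E]
    [BorelSpace E] [IsProbabilityMeasure μ] {f : E → ℝ} (hf : ContDiff ℝ 2 f) {xs : E}
    (hxs : basin (fun y => -gradient f y) xs ∈ 𝓝 xs) {a β : ℕ → ℝ} (ha : ∀ n, 0 ≤ a n)
    (ha_lim : Tendsto a atTop (𝓝 0))
    (ha_sum : Tendsto (fun n => ∑ k ∈ Finset.range n, a k) atTop atTop) (hβ : ∀ n, 0 ≤ β n)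
    (hβ_sum : Summable fun n => β n ^ 2) {x b : ℕ → Ω → E} (hxℱ : Adapted ℱ x)
    (hxβ : ∀ n, eLpNorm (x n - x (n + 1)) 2 μ ≤ ENNReal.ofReal (β n))
    (hcond : ∀ n, μ[x n - x (n + 1) | ℱ n] =ᵐ[μ] fun ω => a n • (gradient f (x n ω) + b n ω))
    (hbdd : ∀ᵐ ω ∂μ, BddAbove (Set.range fun n => ‖x n ω‖))
    (hb : ∀ᵐ ω ∂μ, Tendsto (fun n => b n ω) atTop (𝓝 0))
    (hcluster : ∀ᵐ ω ∂μ, ∃ y ∈ basin (fun y => -gradient f y) xs,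
      MapClusterPt y atTop fun n => x n ω) :
    ∀ᵐ ω ∂μ, Tendsto (fun n => x n ω) atTop (𝓝 xs) := by
  have hnoise := ae_exists_tendsto_sum_sub_condExp (μ := μ) (ℱ := ℱ)
    (fun n => ((hxℱ n).mono (ℱ.mono n.le_succ) le_rfl).stronglyMeasurable.sub
      (hxℱ (n + 1)).stronglyMeasurable) hβ hxβ hβ_sum
  filter_upwards [hbdd, hb, hcluster, hnoise, ae_all_iff.2 hcond]
    with ω ⟨R, hR⟩ hbω ⟨y, hy, hycl⟩ ⟨S, hS⟩ hω
  refine tendsto_of_mapClusterPt_basin_of_summable_noise hf hxs ha ha_lim ha_sum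
    (w := fun n => -(x n - x (n + 1) - μ[x n - x (n + 1) | ℱ n]) ω) (fun n => ?_)
    (by simpa only [neg_zero] using hbω.neg)
    (by simpa only [Pi.neg_apply, Finset.sum_neg_distrib] using hS.neg)
    (fun n => hR ⟨n, rfl⟩) hy hycl
  simp only [Pi.sub_apply, hω]
  module

end Martingale

/-! ### Two-point gradient estimates -/

section TwoPointEstimate

variable {E : Type*} [NormedAddCommGroup E] [InnerProductSpace ℝ E] {f : E → ℝ} {c δ : ℝ}

/-- The estimate of `∇f(x)` from the values of `f` at `x ± δv`, where `e` is the difference of the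
two measurement errors and `c` normalizes the second moments of the random direction `v`. -/
noncomputable def twoPointEstimate (c : ℝ) (f : E → ℝ) (δ : ℝ) (x v : E) (e : ℝ) : E :=
  (c * ((f (x + δ • v) - f (x - δ • v) + e) / (2 * δ))) • v

theorem twoPointEstimate_eq_add_smul (c : ℝ) (f : E → ℝ) (δ : ℝ) (x v : E) (e : ℝ) :
    twoPointEstimate c f δ x v e = twoPointEstimate c f δ x v 0 + e • (c / (2 * δ)) • v := by
  simp only [twoPointEstimate]
  module

theorem continuous_twoPointEstimate (c : ℝ) (hf : Continuous f) (δ e : ℝ) :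
    Continuous fun q : E × E => twoPointEstimate c f δ q.1 q.2 e := by
  unfold twoPointEstimate
  fun_prop

theorem norm_twoPointEstimate_le {K : ℝ} {v : E} (hδ : 0 < δ) (hv : ‖v‖ ≤ K) (x : E) (e : ℝ) :
    ‖twoPointEstimate c f δ x v e‖ ≤
      |c| * K / (2 * δ) * ‖f (x + δ • v) - f (x - δ • v) + e‖ := by
  calc ‖twoPointEstimate c f δ x v e‖
      = |c| / (2 * δ) * ‖f (x + δ • v) - f (x - δ • v) + e‖ * ‖v‖ := by
        rw [twoPointEstimate, norm_smul, norm_mul, norm_div, Real.norm_eq_abs c,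
          Real.norm_of_nonneg (by positivity : 0 ≤ 2 * δ)]
        ring
    _ ≤ |c| / (2 * δ) * ‖f (x + δ • v) - f (x - δ • v) + e‖ * K := by gcongr
    _ = |c| * K / (2 * δ) * ‖f (x + δ • v) - f (x - δ • v) + e‖ := by ring

theorem abs_symmetricQuotient_sub_inner_gradient_le [CompleteSpace E] (hf : Differentiable ℝ f)
    {s : Set E} {L : NNReal} (hs : Convex ℝ s) (hL : LipschitzOnWith L (fun x => -gradient f x) s)
    {x v : E} (hx : x ∈ s) (hadd : x + δ • v ∈ s) (hsub : x - δ • v ∈ s) (hδ : 0 < δ) :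
    |(f (x + δ • v) - f (x - δ • v)) / (2 * δ) - inner ℝ (gradient f x) v| ≤
      L * ‖v‖ ^ 2 * δ := by
  have hforward := abs_sub_sub_inner_gradient_le hf hs hL hx hadd
  have hbackward := abs_sub_sub_inner_gradient_le hf hs hL hx hsub
  rw [add_sub_cancel_left, inner_smul_right, norm_smul, Real.norm_of_nonneg hδ.le] at hforward
  rw [sub_sub_cancel_left, norm_neg, inner_neg_right, inner_smul_right, norm_smul,
    Real.norm_of_nonneg hδ.le] at hbackward
  have hsplit : (f (x + δ • v) - f (x - δ • v)) / (2 * δ) - inner ℝ (gradient f x) v =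
      ((f (x + δ • v) - f x - δ * inner ℝ (gradient f x) v) -
        (f (x - δ • v) - f x - -(δ * inner ℝ (gradient f x) v))) / (2 * δ) := by
    field_simp
    ring
  rw [hsplit, abs_div, abs_of_pos (by positivity : 0 < 2 * δ), div_le_iff₀ (by positivity)]
  linarith [abs_sub (f (x + δ • v) - f x - δ * inner ℝ (gradient f x) v)
    (f (x - δ • v) - f x - -(δ * inner ℝ (gradient f x) v))]

theorem norm_twoPointEstimate_sub_le [CompleteSpace E] (hf : Differentiable ℝ f) {s : Set E}
    {L : NNReal} (hs : Convex ℝ s) (hL : LipschitzOnWith L (fun x => -gradient f x) s)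
    {x v : E} (hx : x ∈ s) (hadd : x + δ • v ∈ s) (hsub : x - δ • v ∈ s) (hδ : 0 < δ) :
    ‖twoPointEstimate c f δ x v 0 - (c * inner ℝ (gradient f x) v) • v‖ ≤
      |c| * L * ‖v‖ ^ 3 * δ := by
  have hquot := abs_symmetricQuotient_sub_inner_gradient_le hf hs hL hx hadd hsub hδ
  rw [twoPointEstimate, add_zero, ← sub_smul, ← mul_sub, norm_smul, norm_mul, Real.norm_eq_abs,
    Real.norm_eq_abs]
  calc |c| * |(f (x + δ • v) - f (x - δ • v)) / (2 * δ) - inner ℝ (gradient f x) v| * ‖v‖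
      ≤ |c| * (L * ‖v‖ ^ 2 * δ) * ‖v‖ := by gcongr
    _ = |c| * L * ‖v‖ ^ 3 * δ := by ring

end TwoPointEstimate

section Bias

theorem integrable_comp_of_continuous_of_ae_norm_le {Ω E F : Type*} [MeasurableSpace Ω]
    {μ : Measure Ω} [IsFiniteMeasure μ] [NormedAddCommGroup E] [ProperSpace E]
    [NormedAddCommGroup F] {h : E → F} (hh : Continuous h) {D : Ω → E}
    (hD : AEStronglyMeasurable D μ) {K : ℝ} (hK : ∀ᵐ ω ∂μ, ‖D ω‖ ≤ K) :
    Integrable (fun ω => h (D ω)) μ := by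
  obtain ⟨C, hC⟩ := (isCompact_closedBall (0 : E) K).exists_bound_of_continuousOn hh.continuousOn
  refine Integrable.of_bound (hh.comp_aestronglyMeasurable hD) C ?_
  filter_upwards [hK] with ω hω using hC _ (mem_closedBall_zero_iff.2 hω)

variable {Ω E : Type*} [MeasurableSpace Ω] {μ : Measure Ω} [NormedAddCommGroup E]
  [InnerProductSpace ℝ E] {f : E → ℝ} {c δ K : ℝ} {D : Ω → E}

/-- The conditional mean of `twoPointEstimate` at `x`, when the random direction `D` is independent
of the past and the measurement errors have conditional mean zero. -/
noncomputable def meanEstimate (μ : Measure Ω) (c : ℝ) (f : E → ℝ) (δ : ℝ) (D : Ω → E) (x : E) :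
    E :=
  ∫ ω, twoPointEstimate c f δ x (D ω) 0 ∂μ

/-- The random direction `D` is isotropic with constant `c`: its second-moment operator
`v ↦ 𝔼[⟪v, D⟫ D]` is `c⁻¹` times the identity. It makes `c ⟪∇f(x), D⟫ D` an unbiased
estimate of `∇f(x)`. -/
def IsIsotropic (μ : Measure Ω) (c : ℝ) (D : Ω → E) : Prop :=
  ∀ v, ∫ ω, (c * inner ℝ v (D ω)) • D ω ∂μ = v

variable [IsProbabilityMeasure μ] [FiniteDimensional ℝ E]

theorem norm_meanEstimate_sub_gradient_le (hf : Differentiable ℝ f)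
    (hD : AEStronglyMeasurable D μ) (hK : ∀ᵐ ω ∂μ, ‖D ω‖ ≤ K) (hiso : IsIsotropic μ c D)
    {R : ℝ} {L : NNReal}
    (hL : LipschitzOnWith L (fun x => -gradient f x) (Metric.closedBall 0 (R + K)))
    {x : E} (hx : ‖x‖ ≤ R) (hδ : 0 < δ) (hδ1 : δ ≤ 1) :
    ‖meanEstimate μ c f δ D x - gradient f x‖ ≤ |c| * L * K ^ 3 * δ := by
  have hbound : ∀ᵐ ω ∂μ, ‖twoPointEstimate c f δ x (D ω) 0 -
      (c * inner ℝ (gradient f x) (D ω)) • D ω‖ ≤ |c| * L * K ^ 3 * δ := by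
    filter_upwards [hK] with ω hω
    have hδD : ‖δ • D ω‖ ≤ K := by
      rw [norm_smul, Real.norm_of_nonneg hδ.le]
      exact (mul_le_of_le_one_left (norm_nonneg _) hδ1).trans hω
    have hxK : x ∈ Metric.closedBall 0 (R + K) :=
      mem_closedBall_zero_iff.2 (by linarith [(norm_nonneg _).trans hω])
    refine (norm_twoPointEstimate_sub_le hf (convex_closedBall 0 (R + K)) hL hxK
      (mem_closedBall_zero_iff.2 (norm_add_le_of_le hx hδD))
      (mem_closedBall_zero_iff.2 (norm_sub_le_of_le hx hδD)) hδ).trans ?_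
    gcongr
  have hint : Integrable (fun ω => twoPointEstimate c f δ x (D ω) 0) μ :=
    integrable_comp_of_continuous_of_ae_norm_le
      ((continuous_twoPointEstimate c hf.continuous δ 0).comp (by fun_prop : Continuous (x, ·)))
      hD hK
  have hint_lin : Integrable (fun ω => (c * inner ℝ (gradient f x) (D ω)) • D ω) μ :=
    integrable_comp_of_continuous_of_ae_norm_le
      (h := fun v => (c * inner ℝ (gradient f x) v) • v) (by fun_prop) hD hK
  calc ‖meanEstimate μ c f δ D x - gradient f x‖
      = ‖∫ ω, (twoPointEstimate c f δ x (D ω) 0 -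
          (c * inner ℝ (gradient f x) (D ω)) • D ω) ∂μ‖ := by
        rw [integral_sub hint hint_lin, hiso, meanEstimate]
    _ ≤ |c| * L * K ^ 3 * δ := by
        simpa using norm_integral_le_of_norm_le_const hbound

theorem tendsto_meanEstimate_sub_gradient (hf : ContDiff ℝ 2 f) {D : ℕ → Ω → E}
    (hD : ∀ n, AEStronglyMeasurable (D n) μ) (hK : ∀ n, ∀ᵐ ω ∂μ, ‖D n ω‖ ≤ K)
    (hiso : ∀ n, IsIsotropic μ c (D n)) {δ : ℕ → ℝ} (hδ : ∀ n, 0 < δ n)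
    (hδ_lim : Tendsto δ atTop (𝓝 0)) {R : ℝ} {x : ℕ → E} (hx : ∀ n, ‖x n‖ ≤ R) :
    Tendsto (fun n => meanEstimate μ c f (δ n) (D n) (x n) - gradient f (x n)) atTop (𝓝 0) := by
  obtain ⟨L, hL⟩ := exists_lipschitzOnWith_neg_gradient hf (isCompact_closedBall (0 : E) (R + K))
  refine squeeze_zero_norm' ?_ (by simpa using hδ_lim.const_mul (|c| * L * K ^ 3))
  filter_upwards [hδ_lim.eventually_le_const one_pos] with n hn
  exact norm_meanEstimate_sub_gradient_le (hf.differentiable two_ne_zero) (hD n) (hK n) (hiso n)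
    hL (hx n) (hδ n) hn

end Bias

section RandomEstimate

variable {Ω E : Type*} {m m0 : MeasurableSpace Ω} {μ : Measure Ω} [NormedAddCommGroup E]
  [InnerProductSpace ℝ E] {f : E → ℝ} {c δ K : ℝ} {X D : Ω → E} {ξ : Ω → ℝ}

theorem eLpNorm_twoPointEstimate_le {q : ENNReal} (hδ : 0 < δ) (hK : ∀ᵐ ω ∂μ, ‖D ω‖ ≤ K) :
    eLpNorm (fun ω => twoPointEstimate c f δ (X ω) (D ω) (ξ ω)) q μ ≤
      ENNReal.ofReal (|c| * K / (2 * δ)) *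
        eLpNorm (fun ω => f (X ω + δ • D ω) - f (X ω - δ • D ω) + ξ ω) q μ := by
  refine eLpNorm_le_mul_eLpNorm_of_ae_le_mul ?_ q
  filter_upwards [hK] with ω hω using norm_twoPointEstimate_le hδ hω _ _

theorem eLpNorm_smul_twoPointEstimate_le {q : ENNReal} (hq : 1 ≤ q) {a : ℝ} (ha : 0 ≤ a)
    (hδ : 0 < δ) {K : NNReal} (hK : ∀ᵐ ω ∂μ, ‖D ω‖ ≤ K)
    (hfXD : AEStronglyMeasurable (fun ω => f (X ω + δ • D ω) - f (X ω - δ • D ω)) μ)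
    (hξ : AEStronglyMeasurable ξ μ) {Cf Cξ : NNReal}
    (hCf : eLpNorm (fun ω => f (X ω + δ • D ω) - f (X ω - δ • D ω)) q μ ≤ Cf)
    (hCξ : eLpNorm ξ q μ ≤ Cξ) :
    eLpNorm (a • fun ω => twoPointEstimate c f δ (X ω) (D ω) (ξ ω)) q μ ≤
      ENNReal.ofReal (a / δ * (|c| * K / 2 * (Cf + Cξ))) := by
  calc eLpNorm (a • fun ω => twoPointEstimate c f δ (X ω) (D ω) (ξ ω)) q μ
      ≤ ENNReal.ofReal a * (ENNReal.ofReal (|c| * K / (2 * δ)) * (Cf + Cξ)) := by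
        rw [eLpNorm_const_smul, Real.enorm_of_nonneg ha]
        gcongr
        exact (eLpNorm_twoPointEstimate_le hδ hK).trans <| mul_le_mul_right
          ((eLpNorm_add_le hfXD hξ hq).trans (add_le_add hCf hCξ)) _
    _ = ENNReal.ofReal (a / δ * (|c| * K / 2 * (Cf + Cξ))) := by
        rw [← ENNReal.coe_add, ← ENNReal.ofReal_coe_nnreal, ← ENNReal.ofReal_mul (by positivity),
          ← ENNReal.ofReal_mul ha, NNReal.coe_add]
        congr 1
        field_simp

variable [IsProbabilityMeasure μ] [FiniteDimensional ℝ E] [MeasurableSpace E] [BorelSpace E]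

theorem condExp_smul_twoPointEstimate (hm : m ≤ m0) (hf : Continuous f) (hδ : 0 < δ)
    (hX : Measurable[m] X) (hD : Measurable D) (hK : ∀ᵐ ω ∂μ, ‖D ω‖ ≤ K)
    (hind : Indep (MeasurableSpace.comap D inferInstance) m μ) (hξ : Integrable ξ μ)
    (hξ0 : μ[ξ | MeasurableSpace.comap D inferInstance ⊔ m] =ᵐ[μ] 0)
    (hfXD : Integrable (fun ω => f (X ω + δ • D ω) - f (X ω - δ • D ω)) μ) (a : ℝ) :
    μ[a • fun ω => twoPointEstimate c f δ (X ω) (D ω) (ξ ω) | m] =ᵐ[μ]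
      fun ω => a • meanEstimate μ c f δ D (X ω) := by
  have hcont := continuous_twoPointEstimate c hf δ 0
  have hX0 : Measurable X := hX.mono hm le_rfl
  have hclean : Integrable (fun ω => twoPointEstimate c f δ (X ω) (D ω) 0) μ := by
    refine Integrable.mono' (hfXD.norm.const_mul (|c| * K / (2 * δ)))
      (hcont.measurable.comp (hX0.prodMk hD)).aestronglyMeasurable ?_
    filter_upwards [hK] with ω hω
    simpa using norm_twoPointEstimate_le hδ hω (X ω) 0
  have hnoise : Integrable (ξ • (c / (2 * δ)) • D) μ := by
    rw [smul_comm]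
    exact (hξ.smul_bdd K hD.aestronglyMeasurable hK).smul (c / (2 * δ))
  have hDm : Measurable[MeasurableSpace.comap D inferInstance ⊔ m] D :=
    (comap_measurable D).mono le_sup_left le_rfl
  have hnoise0 := condExp_smul_eq_zero (μ := μ) le_sup_right (sup_le hD.comap_le hm)
    (hDm.const_smul (c / (2 * δ))).aestronglyMeasurable hξ hnoise hξ0
  simp only [twoPointEstimate_eq_add_smul c f δ _ _ (ξ _)]
  filter_upwards [condExp_smul a (fun ω => twoPointEstimate c f δ (X ω) (D ω) 0 +
      ξ ω • (c / (2 * δ)) • D ω) m, condExp_add hclean hnoise m, hnoise0,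
    condExp_ae_eq_integral_of_indep hm hX hD hind hcont.stronglyMeasurable hclean]
    with ω hsmul hadd hω0 hω
  refine hsmul.trans (congrArg (a • ·) (hadd.trans ?_))
  rw [Pi.add_apply, hω0, hω, Pi.zero_apply, add_zero, meanEstimate]

end RandomEstimate

theorem eLpNorm_two_sub_le_of_lintegral_rpow_le {Ω : Type*} [MeasurableSpace Ω] {μ : Measure Ω}
    [IsProbabilityMeasure μ] {X Y : Ω → ℝ} (hX : AEStronglyMeasurable X μ)
    (hY : AEStronglyMeasurable Y μ) {ζ α : ℝ} (hζ : 0 ≤ ζ)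
    (hXα : ∫⁻ ω, ENNReal.ofReal (|X ω| ^ (2 + ζ)) ∂μ ≤ ENNReal.ofReal α)
    (hYα : ∫⁻ ω, ENNReal.ofReal (|Y ω| ^ (2 + ζ)) ∂μ ≤ ENNReal.ofReal α) :
    eLpNorm (fun ω => X ω - Y ω) 2 μ ≤ (2 * α.toNNReal ^ (1 / (2 + ζ)) : NNReal) := by
  have hq : 0 < 2 + ζ := by positivity
  have hle : 2 ≤ ENNReal.ofReal (2 + ζ) := by
    simpa using ENNReal.ofReal_le_ofReal (le_add_of_nonneg_right hζ : (2 : ℝ) ≤ 2 + ζ)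
  have hmoment : ∀ {Z : Ω → ℝ}, AEStronglyMeasurable Z μ →
      ∫⁻ ω, ENNReal.ofReal (|Z ω| ^ (2 + ζ)) ∂μ ≤ ENNReal.ofReal α →
      eLpNorm Z 2 μ ≤ (α.toNNReal ^ (1 / (2 + ζ)) : NNReal) := fun {Z} hZ hZα => by
    refine (eLpNorm_le_eLpNorm_of_exponent_le hle hZ).trans ?_
    rw [eLpNorm_eq_lintegral_rpow_enorm_toReal (by simpa using hq) ENNReal.ofReal_ne_top,
      ENNReal.toReal_ofReal hq.le, ENNReal.coe_rpow_of_nonneg _ (by positivity)]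
    gcongr
    simp only [Real.enorm_eq_ofReal_abs, ENNReal.ofReal_rpow_of_nonneg (abs_nonneg _) hq.le]
    exact hZα
  calc eLpNorm (fun ω => X ω - Y ω) 2 μ ≤ eLpNorm X 2 μ + eLpNorm Y 2 μ :=
        eLpNorm_sub_le hX hY one_le_two
    _ ≤ (α.toNNReal ^ (1 / (2 + ζ)) : NNReal) + (α.toNNReal ^ (1 / (2 + ζ)) : NNReal) :=
        add_le_add (hmoment hX hXα) (hmoment hY hYα)
    _ = (2 * α.toNNReal ^ (1 / (2 + ζ)) : NNReal) := by rw [two_mul, ENNReal.coe_add]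

/-! ### Perturbations with independent coordinates -/

section Coordinates

variable {Ω ι : Type*} [MeasurableSpace Ω] {μ : Measure Ω} [Fintype ι]
  {d : Ω → EuclideanSpace ℝ ι}

theorem ae_norm_le_of_map_coord_eq {ν : Measure ℝ} {K : NNReal}
    (hd : AEMeasurable d μ) (hlaw : ∀ i, μ.map (fun ω => d ω i) = ν)
    (hK : ∀ᵐ t ∂ν, ‖t‖ ≤ K) : ∀ᵐ ω ∂μ, ‖d ω‖ ≤ (NNReal.sqrt (Fintype.card ι) * K : NNReal) := by
  have hdK : ∀ᵐ ω ∂μ, ∀ i, ‖d ω i‖ ≤ K :=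
    ae_all_iff.2 fun i => ae_of_ae_map (f := fun ω => d ω i) (by fun_prop) (by rwa [hlaw i])
  filter_upwards [hdK] with ω hω
  calc ‖d ω‖ = √(∑ i, ‖d ω i‖ ^ 2) := EuclideanSpace.norm_eq _
    _ ≤ √(∑ _i : ι, (K : ℝ) ^ 2) := by gcongr with i; exact hω i
    _ = (NNReal.sqrt (Fintype.card ι) * K : NNReal) := by simp

theorem isIsotropic_of_pairwise_indepFun {c : ℝ} (hd : ∀ i, MemLp (fun ω => d ω i) 2 μ)
    (hmean : ∀ i, ∫ ω, d ω i ∂μ = 0) (hvar : ∀ i, c * ∫ ω, d ω i ^ 2 ∂μ = 1)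
    (hind : Pairwise fun i j => IndepFun (fun ω => d ω i) (fun ω => d ω j) μ) :
    IsIsotropic μ c d := by
  have hexpand : ∀ (v : EuclideanSpace ℝ ι) (i : ι), (fun ω => ((c * inner ℝ v (d ω)) • d ω) i) =
      fun ω => ∑ j, c * v j * (d ω j * d ω i) := fun v i => by
    ext ω
    simp only [PiLp.smul_apply, PiLp.inner_apply, RCLike.inner_apply, conj_trivial, smul_eq_mul,
      Finset.mul_sum, Finset.sum_mul]
    exact Finset.sum_congr rfl fun j _ => by ring
  have hint : ∀ (v : EuclideanSpace ℝ ι) (i j : ι),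
      Integrable (fun ω => c * v j * (d ω j * d ω i)) μ := fun v i j =>
    ((hd j).integrable_mul (hd i)).const_mul _
  have hcov : ∀ i j, j ≠ i → ∫ ω, d ω j * d ω i ∂μ = 0 := fun i j hji => by
    rw [(hind hji).integral_fun_mul_eq_mul_integral (hd j).1 (hd i).1, hmean, zero_mul]
  intro v
  ext i
  rw [eval_integral_piLp fun i => by
    rw [hexpand]; exact integrable_finsetSum _ fun j _ => hint v i j]
  rw [hexpand, integral_finsetSum _ fun j _ => hint v i j, Finset.sum_eq_single i]
  · simp only [← pow_two]
    rw [integral_const_mul, mul_right_comm, hvar, one_mul]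
  · intro j _ hji
    rw [integral_const_mul, hcov i j hji, mul_zero]
  · simp

end Coordinates

/-! ### The perturbation laws -/

namespace Perturbation

theorem exists_ae_norm_le (p : Perturbation) : ∃ K : NNReal, ∀ᵐ t ∂p.law, ‖t‖ ≤ K := by
  cases p with
  | uniform η hη =>
    refine ⟨.mk η hη.le, ?_⟩
    filter_upwards [ProbabilityTheory.ae_cond_mem measurableSet_Icc] with t ht
    exact abs_le.2 ht
  | asymBernoulli ε hε =>
    refine ⟨.mk (1 + ε) (by positivity), ?_⟩
    rw [law, ae_add_measure_iff]
    constructor <;> refine Measure.ae_smul_measure ?_ _ <;>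
      rw [ae_dirac_iff (measurableSet_le (by fun_prop) (by fun_prop)), NNReal.coe_mk]
    · simp [hε.le]
    · rw [Real.norm_of_nonneg (by positivity)]

theorem integral_law_uniform {η : ℝ} (hη : 0 < η) (g : ℝ → ℝ) :
    ∫ t, g t ∂(uniform η hη).law = (2 * η)⁻¹ * ∫ t in (-η)..η, g t := by
  rw [law, ProbabilityTheory.cond, integral_smul_measure, Real.volume_Icc,
    ENNReal.toReal_inv, ENNReal.toReal_ofReal (by linarith),
    intervalIntegral.integral_of_le (by linarith), integral_Icc_eq_integral_Ioc, smul_eq_mul]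
  congr 2; ring

theorem integral_law_asymBernoulli {ε : ℝ} (hε : 0 < ε) (g : ℝ → ℝ) :
    ∫ t, g t ∂(asymBernoulli ε hε).law =
      (1 + ε) / (2 + ε) * g (-1) + 1 / (2 + ε) * g (1 + ε) := by
  have hint : ∀ x : ℝ, Integrable g (Measure.dirac x) := fun x => integrable_dirac (by simp)
  rw [law, integral_add_measure ((hint _).smul_measure ENNReal.ofReal_ne_top)
    ((hint _).smul_measure ENNReal.ofReal_ne_top), integral_smul_measure, integral_smul_measure,
    integral_dirac, integral_dirac, ENNReal.toReal_ofReal (by positivity),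
    ENNReal.toReal_ofReal (by positivity), smul_eq_mul, smul_eq_mul]

theorem integral_id_law (p : Perturbation) : ∫ t, t ∂p.law = 0 := by
  cases p with
  | uniform η hη => rw [integral_law_uniform, integral_id]; ring
  | asymBernoulli ε hε => rw [integral_law_asymBernoulli]; ring

theorem scale_mul_integral_sq_law (p : Perturbation) : p.scale * ∫ t, t ^ 2 ∂p.law = 1 := by
  cases p with
  | uniform η hη =>
    rw [integral_law_uniform, integral_pow, scale]
    field_simp
    ring
  | asymBernoulli ε hε =>
    rw [integral_law_asymBernoulli, scale]
    field_simp
    ring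

theorem isIsotropic {Ω ι : Type*} [MeasurableSpace Ω] {μ : Measure Ω} [IsFiniteMeasure μ]
    [Fintype ι] {d : Ω → EuclideanSpace ℝ ι} (p : Perturbation)
    (hd : AEMeasurable d μ) (hlaw : ∀ i, μ.map (fun ω => d ω i) = p.law)
    (hind : Pairwise fun i j => IndepFun (fun ω => d ω i) (fun ω => d ω j) μ) :
    IsIsotropic μ p.scale d := by
  obtain ⟨K, hK⟩ := p.exists_ae_norm_le
  have hdi : ∀ i, AEMeasurable (fun ω => d ω i) μ := fun i => by fun_prop
  refine isIsotropic_of_pairwise_indepFun (fun i => ?_) (fun i => ?_) (fun i => ?_) hind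
  · exact MemLp.of_bound (hdi i).aestronglyMeasurable K
      (ae_of_ae_map (hdi i) (by rwa [hlaw i]))
  · rw [← p.integral_id_law, ← hlaw i, integral_map (hdi i) (by fun_prop)]
  · rw [← p.scale_mul_integral_sq_law, ← hlaw i, integral_map (hdi i) (by fun_prop)]

end Perturbation

theorem gradEstimate_eq_twoPointEstimate {N : ℕ} (p : Perturbation) (f : Vec N → ℝ) (δ : ℝ)
    (x d : Vec N) (ξp ξm : ℝ) :
    gradEstimate p f δ x d ξp ξm = twoPointEstimate p.scale f δ x d (ξp - ξm) := by
  rw [gradEstimate, twoPointEstimate, add_sub_add_comm]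

theorem measurable_iterate {N : ℕ} {Ω : Type*} [MeasurableSpace Ω] {p : Perturbation}
    {f : Vec N → ℝ} (hf : Measurable f) {a δ : ℕ → ℝ} {d : ℕ → Ω → Vec N} {ξp ξm : ℕ → Ω → ℝ}
    {x₀ : Ω → Vec N} (hd : ∀ n, Measurable (d n)) (hξp : ∀ n, Measurable (ξp n))
    (hξm : ∀ n, Measurable (ξm n)) (hx₀ : Measurable x₀) (n : ℕ) :
    Measurable (iterate p f a δ d ξp ξm x₀ n) := by
  induction n with
  | zero => exact hx₀
  | succ n ih =>
    have hdn := hd n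
    have hξpn := hξp n
    have hξmn := hξm n
    change Measurable fun ω => iterate p f a δ d ξp ξm x₀ n ω -
      a n • gradEstimate p f (δ n) (iterate p f a δ d ξp ξm x₀ n ω) (d n ω) (ξp n ω) (ξm n ω)
    unfold gradEstimate
    fun_prop

end RDSA

theorem mainTheorem2_general
    {Ω E : Type*} [MeasurableSpace Ω] {μ : Measure Ω} [IsProbabilityMeasure μ]
    [NormedAddCommGroup E] [InnerProductSpace ℝ E] [FiniteDimensional ℝ E] [MeasurableSpace E]
    [BorelSpace E] {f : E → ℝ} {xs : E} (hf : ContDiff ℝ 2 f)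
    (hxs : RDSA.basin (fun y => -gradient f y) xs ∈ 𝓝 xs)
    {a δ : ℕ → ℝ} (ha_pos : ∀ n, 0 < a n) (hδ_pos : ∀ n, 0 < δ n)
    (ha : Tendsto a atTop (𝓝 0)) (hδ : Tendsto δ atTop (𝓝 0))
    (ha_sum : Tendsto (fun n => ∑ k ∈ Finset.range n, a k) atTop atTop)
    (haδ_sum : Summable fun n => (a n / δ n) ^ 2)
    {ℱ : Filtration ℕ ‹MeasurableSpace Ω›} {x d : ℕ → Ω → E} {ξ : ℕ → Ω → ℝ} {c : ℝ}
    (hxℱ : Adapted ℱ x) (hd : ∀ n, Measurable (d n)) (hξ : ∀ n, Measurable (ξ n))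
    (hx : ∀ n ω, x (n + 1) ω =
      x n ω - a n • RDSA.twoPointEstimate c f (δ n) (x n ω) (d n ω) (ξ n ω))
    {K : NNReal} (hK : ∀ n, ∀ᵐ ω ∂μ, ‖d n ω‖ ≤ K)
    (hiso : ∀ n, RDSA.IsIsotropic μ c (d n))
    (hindep : ∀ n, Indep (MeasurableSpace.comap (d n) inferInstance) (ℱ n) μ)
    (hnoise : ∀ n, μ[ξ n | MeasurableSpace.comap (d n) inferInstance ⊔ ℱ n] =ᵐ[μ] 0)
    {Cf Cξ : NNReal}
    (hCf : ∀ n, eLpNorm (fun ω => f (x n ω + δ n • d n ω) - f (x n ω - δ n • d n ω)) 2 μ ≤ Cf)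
    (hCξ : ∀ n, eLpNorm (ξ n) 2 μ ≤ Cξ)
    (hbdd : ∀ᵐ ω ∂μ, BddAbove (Set.range fun n => ‖x n ω‖))
    (hcluster : ∀ᵐ ω ∂μ, ∃ y ∈ RDSA.basin (fun y => -gradient f y) xs,
      MapClusterPt y atTop fun n => x n ω) :
    ∀ᵐ ω ∂μ, Tendsto (fun n => x n ω) atTop (𝓝 xs) := by
  have hfxd : ∀ n, Measurable fun ω => f (x n ω + δ n • d n ω) - f (x n ω - δ n • d n ω) :=
    fun n => by
      have hfm := hf.continuous.measurable
      have hxm := (hxℱ n).mono (ℱ.le n) le_rfl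
      have hdm := hd n
      fun_prop
  have hstep : ∀ n, x n - x (n + 1) =
      a n • fun ω => RDSA.twoPointEstimate c f (δ n) (x n ω) (d n ω) (ξ n ω) := fun n => by
    ext ω; simp [hx]
  refine RDSA.ae_tendsto_of_condExp_increment_eq hf hxs (fun n => (ha_pos n).le) ha ha_sum
    (β := fun n => a n / δ n * (|c| * K / 2 * (Cf + Cξ)))
    (b := fun n ω => RDSA.meanEstimate μ c f (δ n) (d n) (x n ω) - gradient f (x n ω))
    (fun n => by have := ha_pos n; have := hδ_pos n; positivity)
    (by simpa only [mul_pow] using haδ_sum.mul_right _) hxℱ (fun n => ?_) (fun n => ?_) hbdd ?_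
    hcluster
  · rw [hstep]
    exact RDSA.eLpNorm_smul_twoPointEstimate_le one_le_two (ha_pos n).le (hδ_pos n) (hK n)
      (hfxd n).aestronglyMeasurable (hξ n).aestronglyMeasurable (hCf n) (hCξ n)
  · have hξ2 : MemLp (ξ n) 2 μ := ⟨(hξ n).aestronglyMeasurable, (hCξ n).trans_lt (by simp)⟩
    have hfxd2 : MemLp (fun ω => f (x n ω + δ n • d n ω) - f (x n ω - δ n • d n ω)) 2 μ :=
      ⟨(hfxd n).aestronglyMeasurable, (hCf n).trans_lt (by simp)⟩
    simp only [hstep, add_sub_cancel]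
    exact RDSA.condExp_smul_twoPointEstimate (ℱ.le n) hf.continuous (hδ_pos n) (hxℱ n) (hd n)
      (hK n) (hindep n) (hξ2.integrable one_le_two) (hnoise n) (hfxd2.integrable one_le_two) (a n)
  · filter_upwards [hbdd] with ω ⟨R, hR⟩
    exact RDSA.tendsto_meanEstimate_sub_gradient hf (fun n => (hd n).aestronglyMeasurable) hK hiso
      hδ_pos hδ fun n => hR ⟨n, rfl⟩

theorem mainTheorem2
    {Ω : Type*} [MeasurableSpace Ω] (μ : Measure Ω) [IsProbabilityMeasure μ]
    {N : ℕ} (f : RDSA.Vec N → ℝ) (xs : RDSA.Vec N)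
    -- the kind of perturbation, the random inputs and the iterates
    (p : RDSA.Perturbation) (a δ : ℕ → ℝ)
    (d : ℕ → Ω → RDSA.Vec N) (ξp ξm : ℕ → Ω → ℝ) (x₀ : Ω → RDSA.Vec N)
    (hd : ∀ n, Measurable (d n)) (hξp : ∀ n, Measurable (ξp n)) (hξm : ∀ n, Measurable (ξm n))
    (hx₀ : Measurable x₀)
    (x : ℕ → Ω → RDSA.Vec N) (hx : x = RDSA.iterate p f a δ d ξp ξm x₀)
    -- the coordinates of the perturbations have the prescribed law
    (hlaw : ∀ n i, μ.map (fun ω => d n ω i) = p.law)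
    -- the equilibrium
    (hxs : RDSA.IsAsymptoticallyStable f xs)
    -- (A1)
    (hf : ContDiff ℝ 3 f)
    (hf3 : ∃ α₀ : ℝ, ∀ i j k y, |RDSA.thirdPartial f i j k y| < α₀)
    -- (A2)
    (hnoise : ∀ n, μ[ξp n - ξm n |
      MeasurableSpace.comap (d n) inferInstance ⊔ RDSA.history x n] =ᵐ[μ] 0)
    -- (A3)
    (hmoment : ∃ α₁ α₂ ζ : ℝ, 0 < α₁ ∧ 0 < α₂ ∧ 0 < ζ ∧ ∀ n,
      ∫⁻ ω, ENNReal.ofReal (|ξp n ω| ^ (2 + ζ)) ∂μ ≤ ENNReal.ofReal α₁ ∧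
      ∫⁻ ω, ENNReal.ofReal (|ξm n ω| ^ (2 + ζ)) ∂μ ≤ ENNReal.ofReal α₁ ∧
      ∫⁻ ω, ENNReal.ofReal (|f (x n ω + δ n • d n ω)| ^ (2 + ζ)) ∂μ ≤ ENNReal.ofReal α₂ ∧
      ∫⁻ ω, ENNReal.ofReal (|f (x n ω - δ n • d n ω)| ^ (2 + ζ)) ∂μ ≤ ENNReal.ofReal α₂)
    -- (A4)
    (hiid : iIndepFun (fun (q : ℕ × Fin N) ω => d q.1 ω q.2) μ)
    (hindep : ∀ n, Indep (MeasurableSpace.comap (d n) inferInstance) (RDSA.history x n) μ)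
    -- (A5)
    (ha_pos : ∀ n, 0 < a n) (hδ_pos : ∀ n, 0 < δ n)
    (ha : Tendsto a atTop (𝓝 0)) (hδ : Tendsto δ atTop (𝓝 0))
    (ha_sum : Tendsto (fun n => ∑ k ∈ Finset.range n, a k) atTop atTop)
    (haδ_sum : Summable fun n => (a n / δ n) ^ 2)
    -- (A6)
    (hbdd : ∀ᵐ ω ∂μ, BddAbove (Set.range fun n => ‖x n ω‖))
    -- a compact subset of the domain of attraction is visited infinitely often
    (hvisit : ∃ D : Set (RDSA.Vec N), IsCompact D ∧ D ⊆ RDSA.domainOfAttraction f xs ∧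
      ∀ᵐ ω ∂μ, ∃ᶠ n in atTop, x n ω ∈ D) :
    ∀ᵐ ω ∂μ, Tendsto (fun n => x n ω) atTop (𝓝 xs) := by
  obtain ⟨α₁, α₂, ζ, -, -, hζ, hmom⟩ := hmoment
  obtain ⟨D, hD, hDsub, hDvisit⟩ := hvisit
  obtain ⟨r, hr, hball⟩ := hxs.attracting
  obtain ⟨K, hK⟩ := p.exists_ae_norm_le
  have hfm := hf.continuous.measurable
  have hxm : ∀ n, Measurable (x n) := hx ▸ RDSA.measurable_iterate hfm hd hξp hξm hx₀
  have hxsm := fun n => (hxm n).stronglyMeasurable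
  have hstep : ∀ n ω, x (n + 1) ω = x n ω -
      a n • RDSA.twoPointEstimate p.scale f (δ n) (x n ω) (d n ω) ((ξp n - ξm n) ω) := by
    intro n ω
    rw [Pi.sub_apply, ← RDSA.gradEstimate_eq_twoPointEstimate, hx, RDSA.iterate]
  have hiso : ∀ n, RDSA.IsIsotropic μ p.scale (d n) := fun n =>
    p.isIsotropic (hd n).aemeasurable (hlaw n) fun i j hij =>
      hiid.indepFun (i := (n, i)) (j := (n, j)) (by simpa using hij)
  have hcluster : ∀ᵐ ω ∂μ, ∃ y ∈ RDSA.domainOfAttraction f xs,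
      MapClusterPt y atTop fun n => x n ω := hDvisit.mono fun ω hω =>
    (hD.exists_mapClusterPt_of_frequently hω).imp fun y hy => ⟨hDsub hy.1, hy.2⟩
  exact mainTheorem2_general (hf.of_le (by norm_num))
    (mem_of_superset (Metric.ball_mem_nhds xs hr) hball) ha_pos hδ_pos ha hδ ha_sum haδ_sum
    (fun n => (Filtration.stronglyAdapted_natural hxsm n).measurable) hd
    (fun n => (hξp n).sub (hξm n)) hstep
    (fun n => RDSA.ae_norm_le_of_map_coord_eq (hd n).aemeasurable (hlaw n) hK) hiso hindep hnoise
    (fun n => RDSA.eLpNorm_two_sub_le_of_lintegral_rpow_le (by fun_prop) (by fun_prop) hζ.le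
      (hmom n).2.2.1 (hmom n).2.2.2)
    (fun n => RDSA.eLpNorm_two_sub_le_of_lintegral_rpow_le (by fun_prop) (by fun_prop) hζ.le
      (hmom n).1 (hmom n).2.1) hbdd hcluster
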